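/- Let $n\ge 1$ and $L\ge 1$ be integers, $\mathbb{R}_+=[0,\infty)$, and let $F=(f_1,\dots,f_L):\mathbb{R}_+^L\to\mathbb{R}_+^L$ be continuous on $\mathbb{R}_+^L$ and locally Lipschitz in the interior $(0,\infty)^L$. For $v\in\mathbb{R}_+^L$ write $v>0$ if $v_i>0$ for all $i$. Call $F$ non-degenerate if for every permutation $i_1,\dots,i_L$ of $1,\dots,L$, every $1\le k<L$ and every $v\in\mathbb{R}_+^L$ with $v_{i_1}>0,\dots,v_{i_k}>0$ and $v_{i_{k+1}}=\dots=v_{i_L}=0$ one has $f_{i_{k+1}}(v)+\dots+f_{i_L}(v)>0$. Assume that $F$ is non-degenerate and that for every $R>0$ the Dirichlet problem $$-\Delta u_i=f_i(u)\ \text{ in } B_R,\qquad u_i>0\ \text{ in } B_R,\qquad u_i=0\ \text{ on }\partial B_R,\qquad i=1,\dots,L,$$ on the ball $B_R=\{x\in\mathbb{R}^n: |x|<R\}$ has no classical solution $u=(u_1,\dots,u_L)$, $u_i\in C^2(B_R)\cap C(\overline{B_R})$. Then the system $$-\Delta u_i=f_i(u),\qquad u_i>0\qquad\text{in }\mathbb{R}^n,\qquad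 i=1,\dots,L,$$ has a classical solution $u$, $u_i\in C^2(\mathbb{R}^n)$. If, furthermore, $F(v)\ne 0$ for all $v>0$, then this system has a classical solution $u$ such that $u(x)\to 0$ uniformly as $|x|\to\infty$. -/

import Mathlib

open scoped Topology

/-- The closed orthant `ℝ₊^L = [0, ∞)^L`. -/
def closedOrthant (L : ℕ) : Set (Fin L → ℝ) := {v | ∀ i, 0 ≤ v i}

/-- The open orthant `(0, ∞)^L`, the interior of `ℝ₊^L`; `v > 0` means that `v` lies in it. -/
def openOrthant (L : ℕ) : Set (Fin L → ℝ) := {v | ∀ i, 0 < v i}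

/-- The standing assumptions on `F = (f₁, …, f_L) : ℝ₊^L → ℝ₊^L`. Only the values of `F` on the
closed orthant matter. -/
structure IsAdmissible {L : ℕ} (F : (Fin L → ℝ) → Fin L → ℝ) : Prop where
  mapsTo : Set.MapsTo F (closedOrthant L) (closedOrthant L)
  continuousOn : ContinuousOn F (closedOrthant L)
  locallyLipschitzOn : LocallyLipschitzOn (openOrthant L) F

/-- Non-degeneracy (non-reducibility): whenever the indices are split into two nonempty groups
`S = {i₁, …, i_k}` and `Sᶜ = {i_{k+1}, …, i_L}`, and `v` is positive on the first group
and zero on the second one, the sum of the `f_i v` over the second group is positive. -/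
def IsNondegenerate {L : ℕ} (F : (Fin L → ℝ) → Fin L → ℝ) : Prop :=
  ∀ S : Finset (Fin L), S.Nonempty → Sᶜ.Nonempty →
    ∀ v : Fin L → ℝ, (∀ i ∈ S, 0 < v i) → (∀ i ∈ Sᶜ, v i = 0) → 0 < ∑ i ∈ Sᶜ, F v i

/-- `u` is a classical solution of `-Δ u_i = f_i(u)`, `u_i > 0` in `ℝⁿ`, `i = 1, …, L`. -/
structure IsEntireSolution {n L : ℕ} (F : (Fin L → ℝ) → Fin L → ℝ)
    (u : EuclideanSpace ℝ (Fin n) → Fin L → ℝ) : Prop where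
  contDiff : ∀ i, ContDiff ℝ 2 (fun x => u x i)
  equation : ∀ i x, -(Laplacian.laplacian (fun y => u y i) x) = F (u x) i
  pos : ∀ i x, 0 < u x i

/-- `u` is a classical solution, in `C²(B_R) ∩ C(closure B_R)`, of the Dirichlet problem
`-Δ u_i = f_i(u)`, `u_i > 0` in `B_R`, `u_i = 0` on `∂B_R`, `i = 1, …, L`.
Values of `u` outside the closed ball are irrelevant. -/
structure IsDirichletSolution {n L : ℕ} (F : (Fin L → ℝ) → Fin L → ℝ) (R : ℝ)
    (u : EuclideanSpace ℝ (Fin n) → Fin L → ℝ) : Prop where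
  contDiffOn : ∀ i, ContDiffOn ℝ 2 (fun x => u x i) (Metric.ball 0 R)
  continuousOn : ∀ i, ContinuousOn (fun x => u x i) (Metric.closedBall 0 R)
  equation : ∀ i, ∀ x ∈ Metric.ball (0 : EuclideanSpace ℝ (Fin n)) R,
    -(Laplacian.laplacian (fun y => u y i) x) = F (u x) i
  pos : ∀ i, ∀ x ∈ Metric.ball (0 : EuclideanSpace ℝ (Fin n)) R, 0 < u x i
  boundary : ∀ i, ∀ x ∈ Metric.sphere (0 : EuclideanSpace ℝ (Fin n)) R, u x i = 0

/-!
The solutions are radial. In the variable `q = |x|²` a radial solution with value `a` at the origin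
satisfies `u(q) = a - ½ ∫₀^q ∫₀¹ τ^(n-1) F(u(p τ²)) dτ dp`, an equation that is regular at the origin
and whose solutions are Lipschitz and componentwise decreasing while they stay in the orthant.

The argument is a shooting argument, run on approximate equations. After truncating `F` to the unit
cube, adding a small constant to every component and introducing a small delay, solutions exist by
iteration, depend continuously on `a`, and all leave the orthant in finite time. By Brouwer's
theorem some `a` in the standard simplex gives a solution that leaves the orthant through the origin
(`exists_simplex_curve_eq_zero`, `exists_delayedIterate_eq_zero`). By the Arzelà–Ascoli theorem these
solutions converge to a solution `u` for `F` that stays in the closed orthant up to a time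
`Q ≤ ∞` and vanishes at `Q` if `Q < ∞` (`exists_radial_solution_vanishing`).

A component of `u` that vanishes before time `Q` vanishes identically up to a later time, together
with its source (`eq_zero_of_radialPotential_eq_zero`). Then it vanishes at the origin, `a` lies on
the boundary of the simplex, and all its vanishing components have vanishing source, which
non-degeneracy forbids. So `u` is positive before time `Q`. If `Q` were finite, `u` would solve the
Dirichlet problem in the ball of radius `√Q`; hence `Q = ∞` and `u` is an entire solution. Its limit
`ℓ` at infinity satisfies `F ℓ = 0`, since otherwise some component would decrease without bound
(`source_limit_nonpos`). If `F` has no zero in the open orthant, then `ℓ` is on its boundary, and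
non-degeneracy leaves only `ℓ = 0`.

Brouwer's theorem is proved by the volume argument of Milnor and Rogers
(`no_smooth_retraction_ball`). That a radial solution is of class `C²` across the origin and has the
right Laplacian is `contDiff_radialPotential` and `laplacian_radialPotential`.
-/

/-! ### Brouwer's fixed point theorem -/

/-- The determinant of `1 + A` is recovered from finitely many values of the polynomial
`t ↦ det (1 + t A)` by Lagrange interpolation, with weights independent of `A`. -/
theorem det_one_add_eq_sum_lagrange {E : Type*} [NormedAddCommGroup E] [NormedSpace ℝ E]
    [FiniteDimensional ℝ E] (s : Finset ℝ) (hs : Module.finrank ℝ E < s.card) (A : E →L[ℝ] E) :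
    (1 + A).det = ∑ t ∈ s, (Lagrange.basis s id t).eval 1 * (1 + t • A).det := by
  classical
  let b := Module.finBasis ℝ E
  let M : Matrix (Fin (Module.finrank ℝ E)) (Fin (Module.finrank ℝ E)) ℝ :=
    LinearMap.toMatrix b b (A : E →ₗ[ℝ] E)
  let P : Polynomial ℝ := ((Polynomial.X : Polynomial ℝ) • M.map ⇑Polynomial.C +
    (1 : Matrix (Fin (Module.finrank ℝ E)) (Fin (Module.finrank ℝ E)) ℝ).map ⇑Polynomial.C).det
  have hP : ∀ t : ℝ, P.eval t = (1 + t • A).det := by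
    intro t
    have h1 : (1 + t • A).det = (t • M + 1).det := by
      rw [ContinuousLinearMap.det, ← LinearMap.det_toMatrix b]
      congr 1
      simp [M, LinearMap.toMatrix_one, add_comm]
    rw [h1, ← Polynomial.coe_evalRingHom, RingHom.map_det]
    congr 1
    ext i j
    simp only [Matrix.one_apply, Matrix.add_apply, Matrix.smul_apply, Matrix.map_apply,
      RingHom.mapMatrix_apply, Polynomial.coe_evalRingHom, Polynomial.eval_add, smul_eq_mul,
      Polynomial.eval_mul, Polynomial.eval_X, Polynomial.eval_C]
  have hdeg : P.degree < s.card := by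
    refine lt_of_le_of_lt Polynomial.degree_le_natDegree ?_
    have := Polynomial.natDegree_det_X_add_C_le M 1
    rw [Fintype.card_fin] at this
    exact_mod_cast lt_of_le_of_lt this hs
  have h := Lagrange.eq_interpolate (s := s) (v := id) (f := P) (Function.injective_id.injOn) hdeg
  have h1 := hP 1
  rw [one_smul] at h1
  rw [← h1, h, Lagrange.interpolate_apply, Polynomial.eval_finsetSum]
  refine Finset.sum_congr rfl fun t _ => ?_
  simp [hP, mul_comm]

section Retraction

variable {E : Type*} [NormedAddCommGroup E] [InnerProductSpace ℝ E]

theorem eq_zero_of_one_add_smul_apply_eq_zero {A : E →L[ℝ] E} {C t : ℝ} (hA : ‖A‖ ≤ C) (ht : 0 ≤ t)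
    (htC : t * C < 1) {h : E} (hh : (1 + t • A) h = 0) : h = 0 := by
  by_contra hne
  have hpos : 0 < ‖h‖ := norm_pos_iff.2 hne
  have h1 : h = -(t • A h) := by
    have : h + t • A h = 0 := by simpa using hh
    exact eq_neg_of_add_eq_zero_left this
  have h2 : ‖h‖ ≤ t * C * ‖h‖ := by
    calc ‖h‖ = t * ‖A h‖ := by
          conv_lhs => rw [h1]
          rw [norm_neg, norm_smul, Real.norm_of_nonneg ht]
      _ ≤ t * (C * ‖h‖) := by
          gcongr
          exact A.le_of_opNorm_le hA h
      _ = _ := by ring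
  nlinarith

variable [FiniteDimensional ℝ E]

theorem det_one_add_smul_pos {A : E →L[ℝ] E} {C t : ℝ} (hA : ‖A‖ ≤ C) (ht : 0 ≤ t)
    (htC : t * C < 1) : 0 < (1 + t • A).det := by
  have hC : 0 ≤ C := (norm_nonneg _).trans hA
  have hne : ∀ s ∈ Set.Icc 0 t, (1 + s • A).det ≠ 0 := by
    intro s hs h0
    obtain ⟨v, hv, hv0⟩ := SetLike.exists_of_lt (bot_lt_iff_ne_bot.2
      (LinearMap.bot_lt_ker_of_det_eq_zero (f := ((1 + s • A : E →L[ℝ] E) : E →ₗ[ℝ] E)) h0).ne')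
    refine hv0 ?_
    have : s * C < 1 := lt_of_le_of_lt (mul_le_mul_of_nonneg_right hs.2 hC) htC
    simpa using eq_zero_of_one_add_smul_apply_eq_zero hA hs.1 this hv
  have hcont : Continuous fun s : ℝ => (1 + s • A).det :=
    ContinuousLinearMap.continuous_det.comp (by fun_prop)
  by_contra hle
  push Not at hle
  have h0 : (1 + (0 : ℝ) • A).det = 1 := by
    simp [ContinuousLinearMap.det]
  obtain ⟨s, hs, hs0⟩ := intermediate_value_Icc' ht hcont.continuousOn
    (show (0 : ℝ) ∈ Set.Icc _ _ from ⟨hle, by simp only [h0]; norm_num⟩)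
  exact hne s hs hs0

/-- A small Lipschitz perturbation of the identity that fixes the sphere and preserves the closed
ball maps the open ball bijectively onto itself. Surjectivity follows by connectedness: the image
is open by the inverse function theorem and relatively closed by compactness. -/
theorem bijOn_ball_of_perturbation {ρ C t : ℝ} {w : E → E} {D : E → E →L[ℝ] E} (hρ : 0 < ρ)
    (hD : ∀ x ∈ Metric.closedBall (0 : E) ρ, HasStrictFDerivAt w (D x) x)
    (hC : ∀ x ∈ Metric.closedBall (0 : E) ρ, ‖D x‖ ≤ C)
    (hw : ∀ x ∈ Metric.sphere (0 : E) ρ, w x = 0)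
    (hmaps : ∀ x ∈ Metric.closedBall (0 : E) ρ, ‖x + t • w x‖ ≤ ρ)
    (ht : 0 ≤ t) (htC : t * C < 1) :
    Set.BijOn (fun x => x + t • w x) (Metric.ball 0 ρ) (Metric.ball 0 ρ) := by
  set φ : E → E := fun x => x + t • w x with hφ
  have hinj : Set.InjOn φ (Metric.closedBall 0 ρ) := by
    intro x hx y hy hxy
    have h1 : ‖w y - w x‖ ≤ C * ‖y - x‖ :=
      (convex_closedBall (0 : E) ρ).norm_image_sub_le_of_norm_hasFDerivWithin_le
        (fun z hz => (hD z hz).hasFDerivAt.hasFDerivWithinAt) hC hx hy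
    have h2 : y - x = -(t • (w y - w x)) := by
      have : x + t • w x = y + t • w y := hxy
      rw [smul_sub, neg_sub, sub_eq_sub_iff_add_eq_add, ← this, add_comm]
    have h3 : ‖y - x‖ ≤ t * (C * ‖y - x‖) := by
      calc ‖y - x‖ = t * ‖w y - w x‖ := by
            conv_lhs => rw [h2]
            rw [norm_neg, norm_smul, Real.norm_of_nonneg ht]
        _ ≤ _ := by gcongr
    by_contra hne
    have : 0 < ‖y - x‖ := norm_pos_iff.2 (sub_ne_zero.2 (Ne.symm hne))
    nlinarith
  have hder : ∀ x ∈ Metric.closedBall (0 : E) ρ, HasStrictFDerivAt φ (1 + t • D x) x :=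
    fun x hx => (hasStrictFDerivAt_id x).add ((hD x hx).const_smul t)
  have hsphere : ∀ x ∈ Metric.sphere (0 : E) ρ, φ x = x := fun x hx => by simp [hφ, hw x hx]
  have hcont : ContinuousOn φ (Metric.closedBall 0 ρ) :=
    fun x hx => (hder x hx).continuousAt.continuousWithinAt
  have hmapsB : Set.MapsTo φ (Metric.ball 0 ρ) (Metric.ball 0 ρ) := by
    intro x hx
    have hxc := Metric.ball_subset_closedBall hx
    rw [mem_ball_zero_iff]
    refine lt_of_le_of_ne (hmaps x hxc) fun heq => ?_
    have hs : φ x ∈ Metric.sphere (0 : E) ρ := mem_sphere_zero_iff_norm.2 heq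
    have := hinj (Metric.sphere_subset_closedBall hs) hxc (hsphere _ hs)
    rw [this] at hs
    exact (mem_ball_zero_iff.1 hx).ne (mem_sphere_zero_iff_norm.1 hs)
  refine ⟨hmapsB, hinj.mono Metric.ball_subset_closedBall, ?_⟩
  have hopen : IsOpen (φ '' Metric.ball 0 ρ) := by
    rw [isOpen_iff_mem_nhds]
    rintro _ ⟨x, hx, rfl⟩
    have hxc := Metric.ball_subset_closedBall hx
    have hker : LinearMap.ker ((1 + t • D x : E →L[ℝ] E) : E →ₗ[ℝ] E) = ⊥ :=
      LinearMap.ker_eq_bot'.2 fun h hh => eq_zero_of_one_add_smul_apply_eq_zero (hC x hxc) ht htC hh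
    rw [← (hder x hxc).map_nhds_eq_of_surj (LinearMap.ker_eq_bot_iff_range_eq_top.1 hker)]
    exact Filter.image_mem_map (Metric.isOpen_ball.mem_nhds hx)
  have hclosed : IsClosed (φ '' Metric.closedBall 0 ρ) :=
    ((isCompact_closedBall (0 : E) ρ).image_of_continuousOn hcont).isClosed
  have hdisj : ∀ y ∈ Metric.ball (0 : E) ρ, y ∈ φ '' Metric.closedBall 0 ρ →
      y ∈ φ '' Metric.ball 0 ρ := by
    rintro y hy ⟨x, hx, rfl⟩
    refine ⟨x, mem_ball_zero_iff.2 (lt_of_le_of_ne (mem_closedBall_zero_iff.1 hx) fun h => ?_), rfl⟩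
    rw [hsphere x (mem_sphere_zero_iff_norm.2 h), mem_ball_zero_iff] at hy
    exact hy.ne h
  have hconn : IsPreconnected (Metric.ball (0 : E) ρ) := (convex_ball 0 ρ).isPreconnected
  refine hconn.subset_left_of_subset_union hopen hclosed.isOpen_compl
    (Set.disjoint_compl_right_iff_subset.2 (Set.image_mono Metric.ball_subset_closedBall))
    (fun y hy => ?_) ?_
  · by_cases h : y ∈ φ '' Metric.closedBall 0 ρ
    · exact Or.inl (hdisj y hy h)
    · exact Or.inr h
  · have h0 : (0 : E) ∈ Metric.ball 0 ρ := Metric.mem_ball_self hρ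
    exact ⟨φ 0, hmapsB h0, 0, h0, rfl⟩

/-- There is no `C¹` retraction `x ↦ x + w x` of a ball onto its boundary sphere. For small `t`
the maps `x ↦ x + t w x` preserve the volume of the ball, which is a polynomial in `t`, hence the
integral of the Jacobian at `t = 1` is also this volume; but there the Jacobian vanishes. -/
theorem no_smooth_retraction_ball {ρ : ℝ} {w : E → E} {Ω : Set E} (hρ : 0 < ρ) (hΩ : IsOpen Ω)
    (hsub : Metric.closedBall 0 ρ ⊆ Ω) (hcd : ContDiffOn ℝ 1 w Ω)
    (hw : ∀ x ∈ Metric.sphere (0 : E) ρ, w x = 0)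
    (hr : ∀ x ∈ Metric.closedBall (0 : E) ρ, ‖x + w x‖ = ρ) : False := by
  classical
  let _ : MeasurableSpace E := borel E
  have _ : BorelSpace E := ⟨rfl⟩
  set B : Set E := Metric.ball 0 ρ with hB
  have hBc : B ⊆ Metric.closedBall 0 ρ := Metric.ball_subset_closedBall
  set D : E → E →L[ℝ] E := fderiv ℝ w with hDdef
  have hD : ∀ x ∈ Metric.closedBall (0 : E) ρ, HasStrictFDerivAt w (D x) x := fun x hx =>
    (hcd.contDiffAt (hΩ.mem_nhds (hsub hx))).hasStrictFDerivAt one_ne_zero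
  have hDcont : ContinuousOn D (Metric.closedBall 0 ρ) :=
    (hcd.continuousOn_fderiv_of_isOpen hΩ le_rfl).mono hsub
  obtain ⟨C, hC⟩ := (isCompact_closedBall (0 : E) ρ).exists_bound_of_continuousOn hDcont
  have hC0 : 0 ≤ C := (norm_nonneg _).trans (hC 0 (Metric.mem_closedBall_self hρ.le))
  set ε : ℝ := 1 / (C + 1) with hε
  have hε0 : 0 < ε := by positivity
  have hε1 : ε ≤ 1 := by
    rw [hε, div_le_one (by positivity)]; linarith
  let μ : MeasureTheory.Measure E := MeasureTheory.Measure.addHaar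
  -- For small `t` the deformed map is a volume preserving bijection of the ball.
  have hvol : ∀ t ∈ Set.Ico 0 ε, ∫ x in B, (1 + t • D x).det ∂μ = μ.real B := by
    intro t ht
    have htC : t * C < 1 := by
      calc t * C ≤ ε * C := by gcongr; exact ht.2.le
        _ < 1 := by rw [hε, one_div, inv_mul_lt_iff₀ (by positivity)]; linarith
    have ht1 : t ≤ 1 := ht.2.le.trans hε1
    have hmaps : ∀ x ∈ Metric.closedBall (0 : E) ρ, ‖x + t • w x‖ ≤ ρ := by
      intro x hx
      have hx' := mem_closedBall_zero_iff.1 hx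
      have : x + t • w x = (1 - t) • x + t • (x + w x) := by module
      calc ‖x + t • w x‖ ≤ (1 - t) * ‖x‖ + t * ‖x + w x‖ := by
            rw [this]
            refine (norm_add_le _ _).trans (le_of_eq ?_)
            rw [norm_smul, norm_smul, Real.norm_of_nonneg ht.1,
              Real.norm_of_nonneg (by linarith)]
        _ ≤ (1 - t) * ρ + t * ρ := by
            rw [hr x hx]
            gcongr
        _ = ρ := by ring
    have hbij := bijOn_ball_of_perturbation hρ hD hC hw hmaps ht.1 htC
    have key := MeasureTheory.integral_image_eq_integral_abs_det_fderiv_smul μ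
      (s := B) (f := fun x => x + t • w x) (f' := fun x => 1 + t • D x) measurableSet_ball
      (fun x hx => ((hasFDerivAt_id x).add
        ((hD x (hBc hx)).hasFDerivAt.const_smul t)).hasFDerivWithinAt)
      hbij.injOn (fun _ => (1 : ℝ))
    rw [hbij.image_eq] at key
    simp only [MeasureTheory.integral_const, smul_eq_mul, mul_one,
      MeasureTheory.measureReal_restrict_apply_univ] at key
    rw [hB, key]
    refine MeasureTheory.setIntegral_congr_fun measurableSet_ball fun x hx => ?_
    exact (abs_of_pos (det_one_add_smul_pos (hC x (hBc hx)) ht.1 htC)).symm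
  have hint : ∀ t : ℝ, MeasureTheory.IntegrableOn (fun x => (1 + t • D x).det) B μ := by
    intro t
    have hc : ContinuousOn (fun x => (1 + t • D x).det) (Metric.closedBall 0 ρ) :=
      ContinuousLinearMap.continuous_det.comp_continuousOn
        (continuousOn_const.add (hDcont.const_smul t))
    exact (hc.integrableOn_compact (isCompact_closedBall 0 ρ)).mono_set hBc
  have hdet0 : ∀ x ∈ B, (1 + D x).det = 0 := by
    intro x hx
    by_contra hne
    have hsurj : Function.Surjective ((1 + D x : E →L[ℝ] E) : E →ₗ[ℝ] E) := by
      rw [← LinearMap.range_eq_top, ← LinearMap.ker_eq_bot_iff_range_eq_top]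
      by_contra hk
      exact hne (LinearMap.det_eq_zero_iff_ker_ne_bot.2 hk)
    have hd : HasFDerivAt (fun y => y + w y) (1 + D x) x :=
      (hasFDerivAt_id x).add (hD x (hBc hx)).hasFDerivAt
    have h1 := hd.norm_sq
    have h2 : HasFDerivAt (fun y => ‖y + w y‖ ^ 2) (0 : E →L[ℝ] ℝ) x := by
      refine (hasFDerivAt_const (ρ ^ 2) x).congr_of_eventuallyEq ?_
      filter_upwards [Metric.isOpen_ball.mem_nhds hx] with y hy
      rw [hr y (hBc hy)]
    have h3 := h1.unique h2
    obtain ⟨h, hh⟩ := hsurj (x + w x)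
    have h4 := congrArg (fun l : E →L[ℝ] ℝ => l h) h3
    have hh' : (1 + D x) h = x + w x := hh
    simp only [smul_apply, ContinuousLinearMap.comp_apply, hh',
      innerSL_apply_apply, real_inner_self_eq_norm_sq, hr x (hBc hx),
      zero_apply] at h4
    simp at h4
    exact hρ.ne' h4
  obtain ⟨s, hs, hcard⟩ := (Set.Ico_infinite hε0).exists_subset_card_eq (Module.finrank ℝ E + 1)
  have hsinj : Set.InjOn (id : ℝ → ℝ) s := Function.injective_id.injOn
  have hsne : s.Nonempty := Finset.card_pos.1 (by omega)
  have hsum1 : ∑ t ∈ s, (Lagrange.basis s id t).eval (1 : ℝ) = 1 := by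
    rw [← Polynomial.eval_finsetSum, Lagrange.sum_basis hsinj hsne, Polynomial.eval_one]
  have hfin : ∫ x in B, (1 + D x).det ∂μ = μ.real B := by
    calc ∫ x in B, (1 + D x).det ∂μ
        = ∫ x in B, ∑ t ∈ s, (Lagrange.basis s id t).eval 1 * (1 + t • D x).det ∂μ := by
          congr 1; ext x
          exact det_one_add_eq_sum_lagrange s (by omega) (D x)
      _ = ∑ t ∈ s, (Lagrange.basis s id t).eval 1 * μ.real B := by
          rw [MeasureTheory.integral_finsetSum _ fun t _ => (hint t).const_mul _]
          refine Finset.sum_congr rfl fun t ht => ?_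
          rw [MeasureTheory.integral_const_mul, hvol t (hs ht)]
      _ = μ.real B := by rw [← Finset.sum_mul, hsum1, one_mul]
  rw [MeasureTheory.setIntegral_congr_fun (g := fun _ => (0 : ℝ)) measurableSet_ball hdet0,
    MeasureTheory.integral_zero] at hfin
  have hpos : 0 < μ.real B :=
    ENNReal.toReal_pos (Metric.measure_ball_pos μ 0 hρ).ne' MeasureTheory.measure_ball_lt_top.ne
  exact hpos.ne hfin

/-- **Brouwer's theorem** in a Euclidean space, for continuous maps with bounded range. If a
smooth approximation `g` has no fixed point, following the ray from `g x` through `x` up to the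
sphere is a smooth retraction of a large ball. -/
theorem exists_fixedPoint_of_bounded_inner {f : E → E} {R : ℝ} (hf : Continuous f)
    (hR : ∀ x, ‖f x‖ ≤ R) : ∃ x, f x = x := by
  by_contra! hno
  have hR0 : 0 ≤ R := (norm_nonneg _).trans (hR 0)
  set ρ : ℝ := R + 1 with hρdef
  have hρ : 0 < ρ := by positivity
  obtain ⟨g, hg, hgf, -⟩ := hf.exists_contDiff_approx 1
    (ε := fun x => min ‖f x - x‖ 1) (by fun_prop)
    (fun x => lt_min (norm_pos_iff.2 (sub_ne_zero.2 (hno x))) one_pos)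
  have hgρ : ∀ x, ‖g x‖ < ρ := by
    intro x
    have h1 : ‖g x - f x‖ < 1 := by
      rw [← dist_eq_norm]; exact (hgf x).trans_le (min_le_right _ _)
    calc ‖g x‖ = ‖f x + (g x - f x)‖ := by congr 1; abel
      _ ≤ ‖f x‖ + ‖g x - f x‖ := norm_add_le _ _
      _ < ρ := by linarith [hR x]
  have hgne : ∀ x, x - g x ≠ 0 := by
    intro x h
    have h1 := (hgf x).trans_le (min_le_left _ _)
    rw [← sub_eq_zero.1 h, dist_comm, dist_eq_norm] at h1
    exact lt_irrefl _ h1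
  set v : E → E := fun x => x - g x with hv
  have hg1 : ContDiff ℝ 1 g := by exact_mod_cast hg
  have hvcd : ContDiff ℝ 1 v := contDiff_id.sub hg1
  set b : E → ℝ := fun x => inner ℝ x (v x) with hb
  have hbcd : ContDiff ℝ 1 b := contDiff_id.inner ℝ hvcd
  set d : E → ℝ := fun x => b x ^ 2 + ‖v x‖ ^ 2 * (ρ ^ 2 - ‖x‖ ^ 2) with hd
  have hdcd : ContDiff ℝ 1 d := (hbcd.pow 2).add
    ((hvcd.norm_sq ℝ).mul (contDiff_const.sub (contDiff_id.norm_sq ℝ)))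
  have hvpos : ∀ x, 0 < ‖v x‖ ^ 2 := fun x => pow_pos (norm_pos_iff.2 (hgne x)) 2
  have hbs : ∀ x, ‖x‖ = ρ → 0 < b x := by
    intro x hx
    have h1 : b x = ρ ^ 2 - inner ℝ x (g x) := by
      simp only [hb, hv, inner_sub_right, real_inner_self_eq_norm_sq, hx]
    have h2 : inner ℝ x (g x) ≤ ρ * ‖g x‖ := hx ▸ real_inner_le_norm x (g x)
    have h3 := hgρ x
    nlinarith
  have hdpos : ∀ x ∈ Metric.closedBall (0 : E) ρ, 0 < d x := by
    intro x hx
    rcases (mem_closedBall_zero_iff.1 hx).lt_or_eq with h | h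
    · have : 0 < ρ ^ 2 - ‖x‖ ^ 2 := by nlinarith [norm_nonneg x]
      have := mul_pos (hvpos x) this
      have := sq_nonneg (b x)
      simp only [hd]; linarith
    · have := hbs x h
      simp only [hd, h, sub_self, mul_zero, add_zero]
      positivity
  refine no_smooth_retraction_ball (w := fun x => ((-b x + √(d x)) / ‖v x‖ ^ 2) • v x)
    (Ω := {x | 0 < d x}) hρ (isOpen_lt continuous_const hdcd.continuous) hdpos ?_ ?_ ?_
  · refine ContDiffOn.smul (ContDiffOn.div (hbcd.neg.contDiffOn.add ?_)
      (hvcd.norm_sq ℝ).contDiffOn fun x _ => (hvpos x).ne') hvcd.contDiffOn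
    exact hdcd.contDiffOn.sqrt fun x hx => ne_of_gt hx
  · intro x hx
    have hx' := mem_sphere_zero_iff_norm.1 hx
    have h1 : √(d x) = b x := by
      simp only [hd, hx', sub_self, mul_zero, add_zero]
      exact Real.sqrt_sq (hbs x hx').le
    simp [h1]
  · intro x hx
    have hs := Real.sq_sqrt (hdpos x hx).le
    have hv0 : ‖v x‖ ≠ 0 := norm_ne_zero_iff.2 (hgne x)
    have h1 : ‖x + ((-b x + √(d x)) / ‖v x‖ ^ 2) • v x‖ ^ 2 = ρ ^ 2 := by
      rw [norm_add_sq_real, inner_smul_right, norm_smul, mul_pow, Real.norm_eq_abs, sq_abs]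
      change ‖x‖ ^ 2 + 2 * ((-b x + √(d x)) / ‖v x‖ ^ 2 * b x) + _ = _
      have hs' : √(d x) ^ 2 = b x ^ 2 + ‖v x‖ ^ 2 * (ρ ^ 2 - ‖x‖ ^ 2) := hs
      clear_value ρ
      field_simp
      linear_combination hs'
    exact (sq_eq_sq₀ (norm_nonneg _) hρ.le).1 h1

end Retraction

/-- **Brouwer's fixed point theorem** for continuous self-maps with bounded range of a
finite-dimensional normed space. -/
theorem exists_fixedPoint_of_bounded {V : Type*} [NormedAddCommGroup V] [NormedSpace ℝ V]
    [FiniteDimensional ℝ V] {f : V → V} {R : ℝ} (hf : Continuous f) (hR : ∀ x, ‖f x‖ ≤ R) :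
    ∃ x, f x = x := by
  let e : V ≃L[ℝ] EuclideanSpace ℝ (Fin (Module.finrank ℝ V)) :=
    ContinuousLinearEquiv.ofFinrankEq (by simp)
  obtain ⟨y, hy⟩ := exists_fixedPoint_of_bounded_inner (f := fun y => e (f (e.symm y)))
    (R := ‖(e : V →L[ℝ] EuclideanSpace ℝ (Fin (Module.finrank ℝ V)))‖ * R) (by fun_prop)
    (fun y => (e : V →L[ℝ] EuclideanSpace ℝ (Fin (Module.finrank ℝ V))).le_opNorm_of_le (hR _))
  exact ⟨e.symm y, e.injective (by rw [hy, e.apply_symm_apply])⟩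

/-! ### The radial Poisson equation -/

/-- The mean `∫₀¹ τ^(n-1) f(p τ²) dτ`: up to the area of the unit sphere, the integral over the
unit ball of `ℝⁿ` of `y ↦ f(p |y|²)`. Radial functions are parametrized by the square `p` of the
radius, which keeps them smooth at the origin. -/
noncomputable def radialMean (n : ℕ) (f : ℝ → ℝ) (p : ℝ) : ℝ :=
  ∫ τ in (0 : ℝ)..1, τ ^ (n - 1) * f (p * τ ^ 2)

theorem continuous_radialMean {n : ℕ} {f : ℝ → ℝ} (hf : Continuous f) :
    Continuous (radialMean n f) := by
  refine intervalIntegral.continuous_parametric_intervalIntegral_of_continuous'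
    (f := fun p τ : ℝ => τ ^ (n - 1) * f (p * τ ^ 2)) ?_ 0 1
  simp only [Function.uncurry_def]
  fun_prop

theorem radialMean_const {n : ℕ} (hn : 1 ≤ n) (c p : ℝ) : radialMean n (fun _ => c) p = c / n := by
  have h : n - 1 + 1 = n := by omega
  have h2 : ((n - 1 : ℕ) : ℝ) + 1 = n := by exact_mod_cast h
  simp only [radialMean]
  rw [intervalIntegral.integral_mul_const, integral_pow, h, h2]
  simp [show n ≠ 0 by omega]
  ring

theorem radialMean_zero {n : ℕ} (hn : 1 ≤ n) (f : ℝ → ℝ) : radialMean n f 0 = f 0 / n := by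
  rw [← radialMean_const hn (f 0) 0]
  simp [radialMean]

/-- The scaling form of the mean, `∫₀¹ τ^(n-1) f(s² τ²) dτ = s⁻ⁿ ∫₀ˢ t^(n-1) f(t²) dt`. -/
theorem radialMean_sq {n : ℕ} (hn : 1 ≤ n) (f : ℝ → ℝ) {s : ℝ} (hs : 0 < s) :
    radialMean n f (s ^ 2) = (∫ t in (0 : ℝ)..s, t ^ (n - 1) * f (t ^ 2)) / s ^ n := by
  have h := intervalIntegral.mul_integral_comp_mul_left (a := 0) (b := 1)
    (f := fun t => t ^ (n - 1) * f (t ^ 2)) s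
  rw [mul_zero, mul_one] at h
  rw [← h, eq_div_iff (pow_ne_zero _ hs.ne'), radialMean,
    ← intervalIntegral.integral_const_mul, ← intervalIntegral.integral_mul_const]
  refine intervalIntegral.integral_congr fun τ _ => ?_
  obtain ⟨m, rfl⟩ : ∃ m, n = m + 1 := ⟨n - 1, by omega⟩
  simp only [Nat.add_sub_cancel, mul_pow]
  ring

/-- The mean satisfies `2 p A' = f - n A`. -/
theorem hasDerivAt_radialMean {n : ℕ} (hn : 1 ≤ n) {f : ℝ → ℝ} (hf : Continuous f) {p : ℝ}
    (hp : 0 < p) :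
    HasDerivAt (radialMean n f) ((f p - n * radialMean n f p) / (2 * p)) p := by
  set s := √p with hs
  have hs0 : 0 < s := Real.sqrt_pos.2 hp
  have hsp : s ^ 2 = p := Real.sq_sqrt hp.le
  set K : ℝ → ℝ := fun s => ∫ t in (0 : ℝ)..s, t ^ (n - 1) * f (t ^ 2) with hK
  have hKd : HasDerivAt K (s ^ (n - 1) * f (s ^ 2)) s :=
    (Continuous.integral_hasStrictDerivAt (by fun_prop) 0 s).hasDerivAt
  have hq := hKd.div (hasDerivAt_pow n s) (pow_ne_zero n hs0.ne')
  have hc := hq.comp p (Real.hasDerivAt_sqrt hp.ne')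
  have heq : radialMean n f =ᶠ[𝓝 p] (K / fun x => x ^ n) ∘ fun x => √x := by
    filter_upwards [lt_mem_nhds hp] with x hx
    have := radialMean_sq hn f (Real.sqrt_pos.2 hx)
    rw [Real.sq_sqrt hx.le] at this
    exact this
  refine (hc.congr_of_eventuallyEq heq).congr_deriv ?_
  have hKs : K s = radialMean n f p * s ^ n := by
    rw [← hsp, radialMean_sq hn f hs0, div_mul_cancel₀ _ (pow_ne_zero n hs0.ne')]
  rw [← hs, hKs, hsp]
  obtain ⟨m, rfl⟩ : ∃ m, n = m + 1 := ⟨n - 1, by omega⟩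
  simp only [Nat.add_sub_cancel]
  rw [← hsp]
  have := hs0.ne'
  field_simp
  ring

section Radial

-- Instances on `E →L[ℝ] E →L[ℝ] ℝ` are not found at the default depth.
set_option maxSynthPendingDepth 3

variable {E : Type*} [NormedAddCommGroup E] [InnerProductSpace ℝ E] {n : ℕ} {f : ℝ → ℝ}

variable (E) in
/-- The real inner product as a bilinear map; `innerSL ℝ` is conjugate-linear in form. -/
noncomputable def bilinInner : E →L[ℝ] E →L[ℝ] ℝ := innerSL ℝ

@[simp]
theorem bilinInner_apply (x y : E) : bilinInner E x y = inner ℝ x y := rfl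

@[simp]
theorem norm_bilinInner (x : E) : ‖bilinInner E x‖ = ‖x‖ := innerSL_apply_norm ℝ x

/-- The profile, in the variable `q = |x|²`, of the radial function on `ℝⁿ` with value `c` at the
origin whose negative Laplacian is `x ↦ f(|x|²)`. -/
noncomputable def radialPotential (n : ℕ) (f : ℝ → ℝ) (c : ℝ) (q : ℝ) : ℝ :=
  c - 1 / 2 * ∫ p in (0 : ℝ)..q, radialMean n f p

theorem hasDerivAt_radialPotential (hf : Continuous f) (c q : ℝ) :
    HasDerivAt (radialPotential n f c) (-(1 / 2 * radialMean n f q)) q :=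
  (((continuous_radialMean hf).integral_hasStrictDerivAt 0 q).hasDerivAt.const_mul _).const_sub c

theorem hasFDerivAt_radialPotential (hf : Continuous f) (c : ℝ) (x : E) :
    HasFDerivAt (fun y : E => radialPotential n f c (‖y‖ ^ 2))
      (-radialMean n f (‖x‖ ^ 2) • bilinInner E x) x := by
  have h := (hasDerivAt_radialPotential (n := n) hf c (‖x‖ ^ 2)).comp_hasFDerivAt x
    (hasStrictFDerivAt_norm_sq x).hasFDerivAt
  refine h.congr_fderiv ?_
  ext y
  simp
  ring

/-- The second derivative of `x ↦ radialPotential n f c (|x|²)`. -/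
noncomputable def radialHessian (n : ℕ) (f : ℝ → ℝ) (x : E) : E →L[ℝ] E →L[ℝ] ℝ :=
  -(radialMean n f (‖x‖ ^ 2) • bilinInner E +
    ((f (‖x‖ ^ 2) - n * radialMean n f (‖x‖ ^ 2)) / ‖x‖ ^ 2) •
      (bilinInner E x).smulRight (bilinInner E x))

theorem hasFDerivAt_gradient_radialPotential (hn : 1 ≤ n) (hf : Continuous f) (x : E) :
    HasFDerivAt (fun y : E => -radialMean n f (‖y‖ ^ 2) • bilinInner E y)
      (radialHessian n f x) x := by
  have hinner : HasFDerivAt (fun y : E => bilinInner E y) (bilinInner E) x :=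
    (bilinInner E).hasFDerivAt
  rcases eq_or_ne x 0 with rfl | hx
  · -- At the origin the gradient is `-A(|y|²) y` with `A` merely continuous.
    have h0 : radialHessian n f (0 : E) = -radialMean n f 0 • bilinInner E := by
      simp [radialHessian]
    rw [h0, hasFDerivAt_iff_isLittleO]
    simp only [map_zero, smul_zero, sub_zero]
    have hcont : Filter.Tendsto (fun y : E => -radialMean n f (‖y‖ ^ 2) + radialMean n f 0) (𝓝 0)
        (𝓝 0) := by
      have hc : Continuous fun y : E => -radialMean n f (‖y‖ ^ 2) + radialMean n f 0 := by
        have := continuous_radialMean (n := n) hf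
        fun_prop
      simpa using hc.tendsto 0
    have h1 : (fun y : E => -radialMean n f (‖y‖ ^ 2) + radialMean n f 0) =o[𝓝 0]
        (fun _ => (1 : ℝ)) := (Asymptotics.isLittleO_one_iff ℝ).2 hcont
    have h2 : (fun y : E => bilinInner E y) =O[𝓝 0] (fun y : E => y) :=
      (bilinInner E).isBigO_id _
    have h3 := h1.smul_isBigO h2
    simp only [one_smul] at h3
    refine h3.congr_left fun y => ?_
    rw [add_smul, neg_smul (radialMean n f 0), neg_apply, smul_apply, sub_neg_eq_add]
  · have hp : 0 < ‖x‖ ^ 2 := pow_pos (norm_pos_iff.2 hx) 2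
    have h := (((hasDerivAt_radialMean hn hf hp).comp_hasFDerivAt x
      (hasStrictFDerivAt_norm_sq x).hasFDerivAt).neg).smul hinner
    refine h.congr_fderiv ?_
    ext y z
    simp [radialHessian]
    field_simp
    ring

theorem continuous_radialHessian (hn : 1 ≤ n) (hf : Continuous f) :
    Continuous (radialHessian n f : E → E →L[ℝ] E →L[ℝ] ℝ) := by
  have hA := continuous_radialMean (n := n) hf
  have hA' : Continuous fun x : E => radialMean n f (‖x‖ ^ 2) := by fun_prop
  refine ((hA'.smul (continuous_const (y := bilinInner E))).add
    (?_ : Continuous fun x : E => ((f (‖x‖ ^ 2) - n * radialMean n f (‖x‖ ^ 2)) / ‖x‖ ^ 2) •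
      (bilinInner E x).smulRight (bilinInner E x))).neg
  rw [continuous_iff_continuousAt]
  intro x
  rcases eq_or_ne x 0 with rfl | hx
  · -- The rank one term tends to `0` at the origin because `f(0) = n A(0)`.
    have hn0 : (n : ℝ) ≠ 0 := by positivity
    have h0 : f 0 - n * radialMean n f 0 = 0 := by
      rw [radialMean_zero hn]; field_simp; ring
    have hlim : Filter.Tendsto (fun x : E => ‖f (‖x‖ ^ 2) - n * radialMean n f (‖x‖ ^ 2)‖) (𝓝 0)
        (𝓝 0) := by
      have hc : Continuous fun x : E => ‖f (‖x‖ ^ 2) - n * radialMean n f (‖x‖ ^ 2)‖ := by fun_prop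
      simpa [h0] using hc.tendsto 0
    rw [ContinuousAt]
    have hz : ((f (‖(0 : E)‖ ^ 2) - n * radialMean n f (‖(0 : E)‖ ^ 2)) / ‖(0 : E)‖ ^ 2) •
      (bilinInner E (0 : E)).smulRight (bilinInner E (0 : E)) = (0 : E →L[ℝ] E →L[ℝ] ℝ) := by simp
    rw [hz]
    refine squeeze_zero_norm (fun y => ?_) hlim
    rw [norm_smul, ContinuousLinearMap.norm_smulRight_apply, norm_bilinInner, norm_div,
      norm_pow, norm_norm]
    rcases eq_or_ne y 0 with rfl | hy
    · simp
    · have := norm_pos_iff.2 hy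
      apply le_of_eq
      field_simp
  · have hp : ‖x‖ ^ 2 ≠ 0 := (pow_pos (norm_pos_iff.2 hx) 2).ne'
    have hq : ContinuousAt (fun x : E => (f (‖x‖ ^ 2) - n * radialMean n f (‖x‖ ^ 2)) / ‖x‖ ^ 2) x :=
      ContinuousAt.div (by fun_prop) (by fun_prop) hp
    refine hq.smul ?_
    have h1 : Continuous fun x : E => bilinInner E x := by fun_prop
    exact ((ContinuousLinearMap.smulRightL ℝ E (E →L[ℝ] ℝ)).continuous.comp h1).continuousAt.clm_apply
      h1.continuousAt

theorem contDiff_radialPotential (hn : 1 ≤ n) (hf : Continuous f) (c : ℝ) :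
    ContDiff ℝ 2 fun x : E => radialPotential n f c (‖x‖ ^ 2) := by
  have h1 : ContDiff ℝ 1 fun y : E => -radialMean n f (‖y‖ ^ 2) • bilinInner E y := by
    have hfd : fderiv ℝ (fun y : E => -radialMean n f (‖y‖ ^ 2) • bilinInner E y) =
        radialHessian n f := funext fun x => (hasFDerivAt_gradient_radialPotential hn hf x).fderiv
    exact contDiff_one_iff_fderiv.2
      ⟨fun x => (hasFDerivAt_gradient_radialPotential hn hf x).differentiableAt,
        hfd ▸ continuous_radialHessian hn hf⟩
  exact (contDiff_succ_iff_hasFDerivAt (n := 1)).2 ⟨_, h1, hasFDerivAt_radialPotential hf c⟩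

theorem laplacian_radialPotential (hn : 1 ≤ n) (hf : Continuous f) (c : ℝ) (x : EuclideanSpace ℝ (Fin n)) :
    Laplacian.laplacian (fun y : EuclideanSpace ℝ (Fin n) => radialPotential n f c (‖y‖ ^ 2)) x = -f (‖x‖ ^ 2) := by
  rw [InnerProductSpace.laplacian_eq_iteratedFDeriv_orthonormalBasis _
    (EuclideanSpace.basisFun (Fin n) ℝ)]
  have hfd : fderiv ℝ (fun y : EuclideanSpace ℝ (Fin n) => radialPotential n f c (‖y‖ ^ 2)) =
      fun y : EuclideanSpace ℝ (Fin n) => -radialMean n f (‖y‖ ^ 2) • bilinInner (EuclideanSpace ℝ (Fin n)) y :=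
    funext fun y => (hasFDerivAt_radialPotential hf c y).fderiv
  simp only [iteratedFDeriv_two_apply, hfd,
    (hasFDerivAt_gradient_radialPotential hn hf x).fderiv]
  have hsum : ∑ i, inner ℝ x (EuclideanSpace.single i (1 : ℝ)) ^ 2 = ‖x‖ ^ 2 := by
    simp [EuclideanSpace.norm_sq_eq, EuclideanSpace.inner_single_right]
  simp [radialHessian, Finset.sum_add_distrib, ← Finset.mul_sum]
  rcases eq_or_ne x 0 with rfl | hx
  · have hn0 : (n : ℝ) ≠ 0 := by positivity
    simp [radialMean_zero hn]
    field_simp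
  · have := norm_pos_iff.2 hx
    field_simp
    rw [hsum]
    ring

end Radial

/-! ### A shooting lemma on the simplex -/

section Shooting

variable {L : ℕ}

/-- A retraction of `ℝ^L` onto the standard simplex: keep the positive part, then normalize it if
its sum exceeds `1` and move it in the direction `(1, …, 1)` if its sum is less than `1`. -/
noncomputable def simplexRetraction (x : Fin L → ℝ) : Fin L → ℝ := fun i =>
  max (x i) 0 / max (∑ j, max (x j) 0) 1 + max (1 - ∑ j, max (x j) 0) 0 / L

theorem continuous_simplexRetraction : Continuous (simplexRetraction (L := L)) := by
  refine continuous_pi fun i => Continuous.add (Continuous.div (by fun_prop) (by fun_prop)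
    fun x => (lt_max_of_lt_right one_pos).ne') (by fun_prop)

theorem simplexRetraction_mem [NeZero L] (x : Fin L → ℝ) :
    simplexRetraction x ∈ stdSimplex ℝ (Fin L) := by
  refine ⟨fun i => by unfold simplexRetraction; positivity, ?_⟩
  have hL : (L : ℝ) ≠ 0 := Nat.cast_ne_zero.2 (NeZero.ne L)
  simp only [simplexRetraction, Finset.sum_add_distrib, ← Finset.sum_div, Finset.sum_const,
    Finset.card_univ, Fintype.card_fin, nsmul_eq_mul]
  rcases le_total (∑ j, max (x j) 0) 1 with h | h
  · rw [max_eq_right h, max_eq_left (sub_nonneg.2 h)]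
    field_simp
    ring
  · rw [max_eq_left h, max_eq_right (sub_nonpos.2 h), div_self (by linarith)]
    simp

theorem simplexRetraction_of_mem {x : Fin L → ℝ} (hx : x ∈ stdSimplex ℝ (Fin L)) :
    simplexRetraction x = x := by
  have h : ∀ j, max (x j) 0 = x j := fun j => max_eq_left (hx.1 j)
  funext i
  simp [simplexRetraction, h, hx.2]

open scoped Fin.NatCast Fin.CommRing in
theorem forall_of_forall_add_one [NeZero L] {P : Fin L → Prop} (h : ∀ i, P (i + 1) → P i)
    {j : Fin L} (hj : P j) (i : Fin L) : P i := by
  have key : ∀ k : ℕ, P (j - (k : Fin L)) := by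
    intro k
    induction k with
    | zero => simpa using hj
    | succ k ih =>
      apply h
      have : j - ((k + 1 : ℕ) : Fin L) + 1 = j - (k : Fin L) := by push_cast; abel
      rwa [this]
  have := key (j - i).val
  rwa [Fin.cast_val_eq_self, sub_sub_cancel] at this

/-- Shooting lemma. Curves `q ↦ U a q` start at the points `a` of the simplex, stay below `a`, and
are nonpositive at time `T`. Then one of them leaves the orthant through the origin. By Brouwer's
theorem the map `(a, q) ↦ (a', q')`, where `q'` is `q` shifted by the least component of `U a q` and
`a'` is `a` pushed in the direction of the cyclically shifted `U a q`, has a fixed point; there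
`U a q` lies on the boundary of the orthant and its zero components propagate cyclically. -/
theorem exists_simplex_curve_eq_zero [NeZero L] {U : (Fin L → ℝ) → ℝ → Fin L → ℝ}
    (hU : Continuous (Function.uncurry U)) {T : ℝ} (hT : 0 ≤ T)
    (h0 : ∀ a ∈ stdSimplex ℝ (Fin L), U a 0 = a)
    (hle : ∀ a ∈ stdSimplex ℝ (Fin L), ∀ q ∈ Set.Icc 0 T, ∀ i, U a q i ≤ a i)
    (hTle : ∀ a ∈ stdSimplex ℝ (Fin L), ∀ i, U a T i ≤ 0) :
    ∃ a ∈ stdSimplex ℝ (Fin L), ∃ q ∈ Set.Icc 0 T, U a q = 0 := by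
  let clamp : ℝ → ℝ := fun q => max 0 (min q T)
  have hclamp : ∀ q, clamp q ∈ Set.Icc 0 T := fun q =>
    ⟨le_max_left _ _, max_le hT (min_le_right _ _)⟩
  have hclampc : Continuous clamp := by fun_prop
  let W : (Fin L → ℝ) × ℝ → Fin L → ℝ := fun z => U (simplexRetraction z.1) (clamp z.2)
  have hW : Continuous W :=
    hU.comp ((continuous_simplexRetraction.comp continuous_fst).prodMk (hclampc.comp continuous_snd))
  let low : (Fin L → ℝ) × ℝ → ℝ := fun z => Finset.univ.inf' Finset.univ_nonempty fun i => W z i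
  have hlow : Continuous low :=
    Continuous.finset_inf'_apply Finset.univ_nonempty fun i _ => (continuous_apply i).comp hW
  let A : (Fin L → ℝ) × ℝ → Fin L → ℝ := fun z i =>
    (simplexRetraction z.1 i + max (W z (i + 1)) 0) / (1 + ∑ j, max (W z j) 0)
  have hden : ∀ z, 0 < 1 + ∑ j, max (W z j) 0 := fun z => by positivity
  have hAmem : ∀ z, A z ∈ stdSimplex ℝ (Fin L) := by
    intro z
    have hs := simplexRetraction_mem z.1
    refine ⟨fun i => div_nonneg (add_nonneg (hs.1 i) (le_max_right _ _)) (hden z).le, ?_⟩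
    simp only [A]
    have hshift : ∑ i, max (W z (i + 1)) 0 = ∑ i, max (W z i) 0 :=
      Equiv.sum_comp (Equiv.addRight (1 : Fin L)) fun j => max (W z j) 0
    rw [← Finset.sum_div, Finset.sum_add_distrib, hs.2, hshift]
    exact div_self (hden z).ne'
  have hA : Continuous A := by
    refine continuous_pi fun i => Continuous.div ?_ ?_ fun z => (hden z).ne'
    · have h1 : Continuous fun z : (Fin L → ℝ) × ℝ => simplexRetraction z.1 i :=
        (continuous_apply i).comp (continuous_simplexRetraction.comp continuous_fst)
      have h2 : Continuous fun z => W z (i + 1) := (continuous_apply _).comp hW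
      fun_prop
    · have h2 : ∀ j, Continuous fun z => W z j := fun j => (continuous_apply _).comp hW
      fun_prop
  obtain ⟨⟨a, q⟩, hz⟩ := exists_fixedPoint_of_bounded (V := (Fin L → ℝ) × ℝ)
    (f := fun z => (A z, clamp (clamp z.2 + low z))) (R := max 1 T)
    (hA.prodMk (hclampc.comp ((hclampc.comp continuous_snd).add hlow))) fun z => by
      refine max_le_max ((pi_norm_le_iff_of_nonneg zero_le_one).2 fun i => ?_) ?_
      · rw [Real.norm_of_nonneg ((hAmem z).1 i), ← (hAmem z).2]
        exact Finset.single_le_sum (fun j _ => (hAmem z).1 j) (Finset.mem_univ i)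
      · rw [Real.norm_of_nonneg (hclamp _).1]
        exact (hclamp _).2
  have hza : A (a, q) = a := congrArg Prod.fst hz
  have hzq : clamp (clamp q + low (a, q)) = q := congrArg Prod.snd hz
  have ha : a ∈ stdSimplex ℝ (Fin L) := hza ▸ hAmem (a, q)
  have hq : q ∈ Set.Icc 0 T := hzq ▸ hclamp _
  have hcq : clamp q = q := by simp [clamp, hq.1, hq.2]
  have hWz : W (a, q) = U a q := by simp only [W, simplexRetraction_of_mem ha, hcq]
  rw [hcq] at hzq
  obtain ⟨j, -, hj⟩ := Finset.exists_mem_eq_inf' Finset.univ_nonempty fun i => W (a, q) i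
  have hlowj : low (a, q) = U a q j := by rw [← hWz]; exact hj
  have hlow0 : low (a, q) = 0 := by
    rcases lt_trichotomy (low (a, q)) 0 with h | h | h
    · -- A negative minimum forces `q = 0`, where `U a 0 = a` is nonnegative.
      have hq0 : q = 0 := by
        rcases hq.1.eq_or_lt with h' | h'
        · exact h'.symm
        · exfalso
          have : clamp (q + low (a, q)) < q :=
            max_lt h' ((min_le_left _ _).trans_lt (by linarith))
          exact this.ne hzq
      rw [hlowj, hq0, h0 a ha] at h
      exact absurd (ha.1 j) (not_le.2 h)
    · exact h
    · -- A positive minimum forces `q = T`, where `U a T` is nonpositive.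
      have hqT : q = T := by
        rcases hq.2.eq_or_lt with h' | h'
        · exact h'
        · exfalso
          have : q < clamp (q + low (a, q)) :=
            lt_max_of_lt_right (lt_min (by linarith) h')
          exact this.ne' hzq
      rw [hlowj, hqT] at h
      exact absurd (hTle a ha j) (not_le.2 h)
  have hnonneg : ∀ i, 0 ≤ U a q i := fun i => by
    rw [← hlow0, ← hWz]
    exact Finset.inf'_le _ (Finset.mem_univ i)
  refine ⟨a, ha, q, hq, funext fun i => ?_⟩
  refine forall_of_forall_add_one (P := fun i => U a q i = 0) (fun i hi => ?_)
    (hlowj ▸ hlow0 : U a q j = 0) i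
  have hAi : (a i + max (U a q (i + 1)) 0) / (1 + ∑ j, max (U a q j) 0) = a i := by
    have := congrFun hza i
    simpa only [A, simplexRetraction_of_mem ha, hWz] using this
  have hi0 : U a q (i + 1) = 0 := hi
  have hd := hden (a, q)
  rw [hWz] at hd
  rw [hi0, max_self, add_zero, div_eq_iff hd.ne'] at hAi
  have hprod : a i * ∑ j, max (U a q j) 0 = 0 := by linarith
  rcases mul_eq_zero.1 hprod with h | h
  · exact le_antisymm (h ▸ hle a ha q hq i) (hnonneg i)
  · have := (Finset.sum_eq_zero_iff_of_nonneg fun j _ => le_max_right _ _).1 h i (Finset.mem_univ i)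
    rwa [max_eq_left (hnonneg i)] at this

end Shooting

/-! ### Estimates for radial potentials -/

section Estimates

variable {n : ℕ} {f g : ℝ → ℝ} {C c q : ℝ}

theorem radialMean_mono (hf : Continuous f) (hg : Continuous g) {p : ℝ}
    (h : ∀ τ ∈ Set.Icc (0 : ℝ) 1, f (p * τ ^ 2) ≤ g (p * τ ^ 2)) :
    radialMean n f p ≤ radialMean n g p := by
  refine intervalIntegral.integral_mono_on zero_le_one
    (Continuous.intervalIntegrable (by fun_prop) _ _)
    (Continuous.intervalIntegrable (by fun_prop) _ _) fun _ hτ =>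
      mul_le_mul_of_nonneg_left (h _ hτ) (pow_nonneg hτ.1 _)

theorem radialMean_nonneg (hf : ∀ t, 0 ≤ f t) (p : ℝ) : 0 ≤ radialMean n f p :=
  intervalIntegral.integral_nonneg zero_le_one fun _ hτ => mul_nonneg (pow_nonneg hτ.1 _) (hf _)

theorem norm_pow_mul_le {τ x : ℝ} (hτ : τ ∈ Set.uIoc (0 : ℝ) 1) (hx : |x| ≤ C) :
    ‖τ ^ (n - 1) * x‖ ≤ C := by
  rw [Set.uIoc_of_le zero_le_one] at hτ
  rw [norm_mul, norm_pow, Real.norm_of_nonneg hτ.1.le, Real.norm_eq_abs]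
  calc τ ^ (n - 1) * |x| ≤ 1 * |x| := by
        gcongr
        exact pow_le_one₀ hτ.1.le hτ.2
    _ ≤ C := by rwa [one_mul]

theorem abs_radialMean_le (hf : ∀ t, |f t| ≤ C) (p : ℝ) : |radialMean n f p| ≤ C := by
  have h := intervalIntegral.norm_integral_le_of_norm_le_const (a := 0) (b := 1) (C := C)
    (f := fun τ => τ ^ (n - 1) * f (p * τ ^ 2)) fun τ hτ => norm_pow_mul_le hτ (hf _)
  simpa using! h

@[simp]
theorem radialPotential_zero : radialPotential n f c 0 = c := by simp [radialPotential]

theorem radialPotential_sub (hf : Continuous f) (q q' : ℝ) :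
    radialPotential n f c q - radialPotential n f c q' =
      -(1 / 2 * ∫ p in q'..q, radialMean n f p) := by
  have hA := continuous_radialMean (n := n) hf
  have := intervalIntegral.integral_interval_sub_left (μ := MeasureTheory.volume)
    (hA.intervalIntegrable 0 q) (hA.intervalIntegrable 0 q')
  rw [radialPotential, radialPotential, ← this]
  ring

theorem abs_radialPotential_sub_le (hf : Continuous f) (hC : ∀ t, |f t| ≤ C) (q q' : ℝ) :
    |radialPotential n f c q - radialPotential n f c q'| ≤ C * |q - q'| := by
  have h := intervalIntegral.norm_integral_le_of_norm_le_const (a := q') (b := q) (C := C)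
    (f := radialMean n f) fun p _ => abs_radialMean_le hC p
  rw [Real.norm_eq_abs] at h
  rw [radialPotential_sub hf, abs_neg, abs_mul]
  have : |(1 / 2 : ℝ)| ≤ 1 := by norm_num [abs_of_pos]
  nlinarith [abs_nonneg (∫ p in q'..q, radialMean n f p)]

theorem antitone_radialPotential (hf : Continuous f) (h0 : ∀ t, 0 ≤ f t) :
    Antitone (radialPotential n f c) := by
  intro q' q h
  have h1 := radialPotential_sub (n := n) (c := c) hf q q'
  have h2 : 0 ≤ ∫ p in q'..q, radialMean n f p :=
    intervalIntegral.integral_nonneg h fun p _ => radialMean_nonneg h0 p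
  linarith

theorem radialPotential_le (hn : 1 ≤ n) (hf : Continuous f) (h : ∀ t, C ≤ f t) (hq : 0 ≤ q) :
    radialPotential n f c q ≤ c - C / (2 * n) * q := by
  have h1 : ∫ p in (0 : ℝ)..q, C / n ≤ ∫ p in (0 : ℝ)..q, radialMean n f p := by
    refine intervalIntegral.integral_mono_on hq (by simp)
      ((continuous_radialMean hf).intervalIntegrable _ _) fun p _ => ?_
    rw [← radialMean_const hn C p]
    exact radialMean_mono continuous_const hf fun τ _ => h _
  rw [intervalIntegral.integral_const, smul_eq_mul, sub_zero] at h1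
  have h2 : C / (2 * n) * q = 1 / 2 * (q * (C / n)) := by
    have : (n : ℝ) ≠ 0 := by positivity
    field_simp
  rw [radialPotential, h2]
  linarith

theorem radialPotential_congr (hq : 0 ≤ q) (h : ∀ t ∈ Set.Icc 0 q, f t = g t) :
    radialPotential n f c q = radialPotential n g c q := by
  rw [radialPotential, radialPotential]
  congr 2
  refine intervalIntegral.integral_congr fun p hp => ?_
  refine intervalIntegral.integral_congr fun τ hτ => ?_
  rw [Set.uIcc_of_le hq] at hp
  rw [Set.uIcc_of_le zero_le_one] at hτ
  have h1 : τ ^ 2 ≤ 1 := pow_le_one₀ hτ.1 hτ.2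
  rw [h _ ⟨mul_nonneg hp.1 (sq_nonneg τ), by nlinarith [hp.1, hp.2]⟩]

theorem continuous_radialPotential_param {X : Type*} [TopologicalSpace X] {f : X → ℝ → ℝ}
    {c q : X → ℝ} (hf : Continuous (Function.uncurry f)) (hc : Continuous c) (hq : Continuous q) :
    Continuous fun x => radialPotential n (f x) (c x) (q x) := by
  have hmean : Continuous fun y : X × ℝ => radialMean n (f y.1) y.2 := by
    refine intervalIntegral.continuous_parametric_intervalIntegral_of_continuous'
      (f := fun (y : X × ℝ) τ => τ ^ (n - 1) * f y.1 (y.2 * τ ^ 2)) ?_ 0 1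
    have : Continuous fun z : (X × ℝ) × ℝ => f z.1.1 (z.1.2 * z.2 ^ 2) :=
      hf.comp (f := fun z : (X × ℝ) × ℝ => (z.1.1, z.1.2 * z.2 ^ 2)) (by fun_prop)
    simp only [Function.uncurry_def]
    fun_prop
  exact hc.sub (continuous_const.mul
    (intervalIntegral.continuous_parametric_intervalIntegral_of_continuous hmean hq))

theorem tendsto_radialPotential {f : ℕ → ℝ → ℝ} {f' : ℝ → ℝ} {c : ℕ → ℝ} {c' : ℝ}
    (hf : ∀ k, Continuous (f k)) (hC : ∀ k t, |f k t| ≤ C)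
    (hlim : ∀ t, Filter.Tendsto (fun k => f k t) Filter.atTop (𝓝 (f' t)))
    (hc : Filter.Tendsto c Filter.atTop (𝓝 c')) (q : ℝ) :
    Filter.Tendsto (fun k => radialPotential n (f k) (c k) q) Filter.atTop
      (𝓝 (radialPotential n f' c' q)) := by
  have hmean : ∀ p, Filter.Tendsto (fun k => radialMean n (f k) p) Filter.atTop
      (𝓝 (radialMean n f' p)) := by
    intro p
    refine intervalIntegral.tendsto_integral_filter_of_dominated_convergence (fun _ => C)
      (.of_forall fun k => ?_) (.of_forall fun k => .of_forall fun τ hτ => ?_)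
      (by simp) (.of_forall fun τ _ => (hlim _).const_mul _)
    · exact Continuous.aestronglyMeasurable (by have := hf k; fun_prop)
    · exact norm_pow_mul_le hτ (hC k _)
  refine hc.sub (Filter.Tendsto.const_mul _ ?_)
  refine intervalIntegral.tendsto_integral_filter_of_dominated_convergence (fun _ => C)
    (.of_forall fun k => (continuous_radialMean (hf k)).aestronglyMeasurable)
    (.of_forall fun k => .of_forall fun p _ => abs_radialMean_le (hC k) p)
    (by simp) (.of_forall fun p _ => hmean p)

end Estimates

/-! ### Approximation by delayed equations -/

section Delayed

variable {n L : ℕ} {G : (Fin L → ℝ) → Fin L → ℝ} {δ : ℝ}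

/-- Successive approximations for the delayed radial system
`u_i(q) = a_i - ½ ∫₀^q ∫₀¹ τ^(n-1) G_i(u(pτ² - δ)) dτ dp`, where `u = a` at negative arguments.
The `m`-th one is exact on `[0, m δ]`, and it depends continuously on `a` although `G` is
merely continuous. -/
noncomputable def delayedIterate (n : ℕ) {L : ℕ} (G : (Fin L → ℝ) → Fin L → ℝ) (δ : ℝ) :
    ℕ → (Fin L → ℝ) → ℝ → Fin L → ℝ
  | 0, a, _ => a
  | m + 1, a, q => fun i =>
    radialPotential n (fun t => G (delayedIterate n G δ m a (max (t - δ) 0)) i) (a i) q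

theorem continuous_delayedIterate (hG : Continuous G) (m : ℕ) :
    Continuous (Function.uncurry (delayedIterate n G δ m)) := by
  induction m with
  | zero => exact continuous_fst
  | succ m ih =>
    refine continuous_pi fun i => ?_
    refine continuous_radialPotential_param (X := (Fin L → ℝ) × ℝ)
      (f := fun z t => G (delayedIterate n G δ m z.1 (max (t - δ) 0)) i)
      (c := fun z => z.1 i) (q := fun z => z.2) ?_ (by fun_prop) continuous_snd
    have h : Continuous fun y : ((Fin L → ℝ) × ℝ) × ℝ =>
        delayedIterate n G δ m y.1.1 (max (y.2 - δ) 0) :=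
      ih.comp (f := fun y : ((Fin L → ℝ) × ℝ) × ℝ => (y.1.1, max (y.2 - δ) 0)) (by fun_prop)
    exact (continuous_apply i).comp (hG.comp h)

theorem continuous_delayedIterate_right (hG : Continuous G) (m : ℕ) (a : Fin L → ℝ) :
    Continuous (delayedIterate n G δ m a) :=
  (continuous_delayedIterate hG m).comp (Continuous.prodMk_right a)

theorem continuous_delayed_source (hG : Continuous G) (m : ℕ) (a : Fin L → ℝ) (i : Fin L) :
    Continuous fun t => G (delayedIterate n G δ m a (max (t - δ) 0)) i := by
  have h := continuous_delayedIterate_right (n := n) (δ := δ) hG m a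
  fun_prop

theorem delayedIterate_succ_eq (hδ : 0 ≤ δ) (a : Fin L → ℝ) (m : ℕ) :
    ∀ q, 0 ≤ q → q ≤ m * δ → delayedIterate n G δ (m + 1) a q = delayedIterate n G δ m a q := by
  induction m with
  | zero =>
    intro q h0 hq
    obtain rfl : q = 0 := le_antisymm (by simpa using hq) h0
    funext i
    simp [delayedIterate]
  | succ m ih =>
    intro q h0 hq
    funext i
    refine radialPotential_congr h0 fun t ht => ?_
    rw [ih _ (le_max_right _ _)]
    refine max_le ?_ (by positivity)
    push_cast at hq
    linarith [ht.2]

/-- On `[0, m δ]` the iterate solves the delayed equation. -/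
theorem delayedIterate_eq (hδ : 0 ≤ δ) (a : Fin L → ℝ) {m : ℕ} {q : ℝ} (h0 : 0 ≤ q)
    (hq : q ≤ m * δ) (i : Fin L) :
    delayedIterate n G δ (m + 1) a q i =
      radialPotential n (fun t => G (delayedIterate n G δ (m + 1) a (max (t - δ) 0)) i) (a i) q := by
  refine radialPotential_congr h0 fun t ht => ?_
  rw [delayedIterate_succ_eq hδ a m _ (le_max_right _ _)]
  exact max_le (by linarith [ht.2]) (by positivity)

/-- If the nonlinearity is bounded below by a positive constant, every solution of the delayed
system leaves the orthant in bounded time, hence some solution leaves it through the origin. -/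
theorem exists_delayedIterate_eq_zero [NeZero L] (hn : 1 ≤ n) (hG : Continuous G) {η : ℝ}
    (hη : 0 < η) (hGη : ∀ v i, η ≤ G v i) (hδ : 0 < δ) (M : ℝ) :
    ∃ m : ℕ, M ≤ m * δ ∧ ∃ a ∈ stdSimplex ℝ (Fin L), ∃ q, 0 ≤ q ∧
      delayedIterate n G δ (m + 1) a q = 0 := by
  obtain ⟨m, hm⟩ := exists_nat_ge (M / δ)
  refine ⟨m, (div_le_iff₀ hδ).1 hm, ?_⟩
  have hn0 : (0 : ℝ) < n := by exact_mod_cast hn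
  have hcont := fun a i => continuous_delayed_source (n := n) (δ := δ) hG m a i
  obtain ⟨a, ha, q, hq, h⟩ := exists_simplex_curve_eq_zero (T := 2 * n / η)
    (continuous_delayedIterate (n := n) (δ := δ) hG (m + 1)) (by positivity)
    (fun a _ => by funext i; simp [delayedIterate])
    (fun a _ q hq i => by
      refine (radialPotential_le hn (hcont a i) (fun t => hGη _ i) hq.1).trans ?_
      have : 0 ≤ η / (2 * n) * q := mul_nonneg (by positivity) hq.1
      linarith)
    (fun a ha i => by
      refine (radialPotential_le hn (hcont a i) (fun t => hGη _ i) (by positivity)).trans ?_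
      have h1 : η / (2 * n) * (2 * n / η) = 1 := by field_simp
      have h2 : a i ≤ 1 := ha.2 ▸ Finset.single_le_sum (fun j _ => ha.1 j) (Finset.mem_univ i)
      rw [h1]
      linarith)
  exact ⟨a, ha, q, hq.1, h⟩

end Delayed

/-! ### Passage to the limit -/

section Limit

variable {n L : ℕ} {F : (Fin L → ℝ) → Fin L → ℝ}

/-- Sequential compactness of equi-Lipschitz curves for locally uniform convergence. -/
theorem isCompact_setOf_lipschitz (K : NNReal) (r : ℝ) :
    IsCompact {w : C(ℝ, Fin L → ℝ) | LipschitzWith K w ∧ ‖w 0‖ ≤ r} := by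
  refine ArzelaAscoli.isCompact_of_equicontinuous _ ?_ ?_
  · have himage : ContinuousMap.toFun '' {w : C(ℝ, Fin L → ℝ) | LipschitzWith K w ∧ ‖w 0‖ ≤ r} =
        {w : ℝ → Fin L → ℝ | LipschitzWith K w ∧ ‖w 0‖ ≤ r} := by
      ext w
      constructor
      · rintro ⟨w, hw, rfl⟩
        exact hw
      · exact fun hw => ⟨⟨w, hw.1.continuous⟩, hw, rfl⟩
    rw [himage]
    refine (isCompact_univ_pi fun q : ℝ =>
      isCompact_closedBall (0 : Fin L → ℝ) (r + K * |q|)).of_isClosed_subset ?_ ?_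
    · simp only [lipschitzWith_iff_dist_le_mul, Set.ofPred_and, Set.ofPred_forall]
      refine IsClosed.inter (isClosed_iInter fun x => isClosed_iInter fun y =>
        isClosed_le ?_ continuous_const) (isClosed_le ?_ continuous_const)
      · exact (continuous_apply x).dist (continuous_apply y)
      · exact (continuous_apply (0 : ℝ)).norm
    · intro w hw q _
      rw [mem_closedBall_zero_iff]
      have h := hw.1.dist_le_mul q 0
      rw [dist_eq_norm, Real.dist_eq, sub_zero] at h
      calc ‖w q‖ = ‖w 0 + (w q - w 0)‖ := by congr 1; abel
        _ ≤ ‖w 0‖ + ‖w q - w 0‖ := norm_add_le _ _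
        _ ≤ r + K * |q| := add_le_add hw.2 h
  · exact (LipschitzWith.uniformEquicontinuous _ K fun w => w.2.1).equicontinuous

/-- Componentwise projection of `ℝ^L` onto the cube `[0, 1]^L`. -/
noncomputable def cubeClamp (v : Fin L → ℝ) : Fin L → ℝ := fun i => max 0 (min (v i) 1)

theorem continuous_cubeClamp : Continuous (cubeClamp (L := L)) := by
  unfold cubeClamp; fun_prop

theorem cubeClamp_mem_closedOrthant (v : Fin L → ℝ) : cubeClamp v ∈ closedOrthant L :=
  fun _ => le_max_left _ _

theorem cubeClamp_eq_self {v : Fin L → ℝ} (h : ∀ i, v i ∈ Set.Icc (0 : ℝ) 1) :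
    cubeClamp v = v := by
  funext i
  simp [cubeClamp, (h i).1, (h i).2]

theorem IsAdmissible.continuous_comp_cubeClamp (hF : IsAdmissible F) :
    Continuous fun v => F (cubeClamp v) :=
  hF.continuousOn.comp_continuous continuous_cubeClamp cubeClamp_mem_closedOrthant

theorem IsAdmissible.comp_cubeClamp_nonneg (hF : IsAdmissible F) (v : Fin L → ℝ) (i : Fin L) :
    0 ≤ F (cubeClamp v) i :=
  hF.mapsTo (cubeClamp_mem_closedOrthant v) i

theorem IsAdmissible.exists_bound (hF : IsAdmissible F) :
    ∃ C, 0 ≤ C ∧ ∀ v i, |F (cubeClamp v) i| ≤ C := by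
  obtain ⟨C, hC⟩ := (isCompact_Icc (a := (0 : Fin L → ℝ)) (b := 1)).exists_bound_of_continuousOn
    (hF.continuousOn.mono fun v hv i => hv.1 i)
  have hmem : ∀ v : Fin L → ℝ, cubeClamp v ∈ Set.Icc (0 : Fin L → ℝ) 1 := fun v =>
    ⟨fun _ => le_max_left _ _, fun _ => max_le zero_le_one (min_le_right _ _)⟩
  refine ⟨C, (norm_nonneg _).trans (hC _ (hmem 0)), fun v i => ?_⟩
  exact (norm_le_pi_norm (F (cubeClamp v)) i).trans (hC _ (hmem v))

theorem norm_le_one_of_mem_stdSimplex {a : Fin L → ℝ} (ha : a ∈ stdSimplex ℝ (Fin L)) :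
    ‖a‖ ≤ 1 := by
  refine (pi_norm_le_iff_of_nonneg zero_le_one).2 fun i => ?_
  rw [Real.norm_of_nonneg (ha.1 i), ← ha.2]
  exact Finset.single_le_sum (fun j _ => ha.1 j) (Finset.mem_univ i)

/-- There is a global radial solution of the system truncated to the unit cube, with value `a` in
the simplex at the origin, that stays in the orthant until a time `Q ≤ ∞` of the variable `|x|²`,
and vanishes identically at time `Q` if `Q` is finite. It is a limit of solutions of delayed
equations, with nonlinearities shifted by `1 / (k + 1)`, that hit the boundary of the orthant at the
origin. -/
theorem exists_radial_solution_vanishing [NeZero L] (hn : 1 ≤ n) (hF : IsAdmissible F) :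
    ∃ a ∈ stdSimplex ℝ (Fin L), ∃ (u : C(ℝ, Fin L → ℝ)) (Q : ENNReal),
      (∀ q, 0 ≤ q → ∀ i, u q i =
        radialPotential n (fun t => F (cubeClamp (u t)) i) (a i) q) ∧
      (∀ q, 0 ≤ q → ENNReal.ofReal q < Q → ∀ i, 0 ≤ u q i) ∧
      (Q ≠ ⊤ → u Q.toReal = 0) := by
  obtain ⟨C, hC0, hC⟩ := hF.exists_bound
  let δ : ℕ → ℝ := fun k => 1 / ((k : ℝ) + 1)
  have hδ : ∀ k, 0 < δ k := fun k => Nat.one_div_pos_of_nat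
  have hδ1 : ∀ k, δ k ≤ 1 := fun k => by
    simp only [δ]
    rw [div_le_one (by positivity)]
    linarith [(Nat.cast_nonneg k : (0 : ℝ) ≤ k)]
  have hδlim : Filter.Tendsto δ Filter.atTop (𝓝 0) := tendsto_one_div_add_atTop_nhds_zero_nat
  let G : ℕ → (Fin L → ℝ) → Fin L → ℝ := fun k v i => F (cubeClamp v) i + δ k
  have hG : ∀ k, Continuous (G k) := fun k => by
    have := hF.continuous_comp_cubeClamp
    refine continuous_pi fun i => ?_
    exact ((continuous_apply i).comp this).add continuous_const
  have hGη : ∀ k v i, δ k ≤ G k v i := fun k v i =>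
    le_add_of_nonneg_left (hF.comp_cubeClamp_nonneg v i)
  have hGC : ∀ k v i, |G k v i| ≤ C + 1 := fun k v i => by
    refine (abs_add_le _ _).trans (add_le_add (hC v i) ?_)
    rw [abs_of_pos (hδ k)]
    exact hδ1 k
  choose m hm a ha Q hQ hzero using fun k : ℕ =>
    exists_delayedIterate_eq_zero (n := n) (L := L) hn (hG k) (hδ k) (hGη k) (hδ k) k
  let u : ℕ → C(ℝ, Fin L → ℝ) := fun k =>
    ⟨delayedIterate n (G k) (δ k) (m k + 1) (a k), continuous_delayedIterate_right (hG k) _ _⟩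
  have hsrc := fun k i => continuous_delayed_source (n := n) (δ := δ k) (hG k) (m k) (a k) i
  have hu0 : ∀ k, u k 0 = a k := fun k => by
    funext i; exact radialPotential_zero
  have hanti : ∀ k i, Antitone fun q => u k q i := fun k i =>
    antitone_radialPotential (hsrc k i) fun t => (hδ k).le.trans (hGη k _ i)
  have hueq : ∀ (k : ℕ) (q : ℝ), 0 ≤ q → q ≤ k → ∀ i, u k q i =
      radialPotential n (fun t => G k (u k (max (t - δ k) 0)) i) (a k i) q :=
    fun k q h0 hq i => delayedIterate_eq (hδ k).le (a k) h0 (hq.trans (hm k)) i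
  have hulip : ∀ k, LipschitzWith (C + 1).toNNReal (u k) := fun k => by
    refine LipschitzWith.of_dist_le_mul fun q q' => ?_
    rw [Real.coe_toNNReal _ (by positivity)]
    refine (dist_pi_le_iff (by positivity)).2 fun i => ?_
    exact abs_radialPotential_sub_le (hsrc k i) (fun t => hGC k _ i) q q'
  obtain ⟨⟨w, Q'⟩, -, φ, hφ, hlim⟩ :=
    ((isCompact_setOf_lipschitz (L := L) (C + 1).toNNReal 1).prod
      (isCompact_univ (X := ENNReal))).tendsto_subseq (x := fun k => (u k, ENNReal.ofReal (Q k)))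
      fun k => ⟨⟨hulip k, by
        rw [hu0 k]; exact norm_le_one_of_mem_stdSimplex (ha k)⟩, Set.mem_univ _⟩
  have hw : Filter.Tendsto (fun k => u (φ k)) Filter.atTop (𝓝 w) :=
    (continuous_fst.tendsto _).comp hlim
  have hQ' : Filter.Tendsto (fun k => ENNReal.ofReal (Q (φ k))) Filter.atTop (𝓝 Q') :=
    (continuous_snd.tendsto _).comp hlim
  have heval : ∀ {t : ℕ → ℝ} {s : ℝ}, Filter.Tendsto t Filter.atTop (𝓝 s) →
      Filter.Tendsto (fun k => u (φ k) (t k)) Filter.atTop (𝓝 (w s)) := fun {t s} ht =>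
    (continuous_eval.tendsto (w, s)).comp (hw.prodMk_nhds ht)
  have hδφ : Filter.Tendsto (fun k => δ (φ k)) Filter.atTop (𝓝 0) := hδlim.comp hφ.tendsto_atTop
  have halim : Filter.Tendsto (fun k => a (φ k)) Filter.atTop (𝓝 (w 0)) := by
    simpa only [hu0] using heval (t := fun _ => 0) tendsto_const_nhds
  refine ⟨w 0, (isClosed_stdSimplex ℝ (Fin L)).mem_of_tendsto halim (.of_forall fun k => ha _), w, Q',
    fun q h0 i => ?_, fun q h0 hq i => ?_, fun hfin => ?_⟩
  · have hsource : ∀ t, Filter.Tendsto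
        (fun k => G (φ k) (u (φ k) (max (t - δ (φ k)) 0)) i) Filter.atTop
        (𝓝 (F (cubeClamp (w (max t 0))) i)) := by
      intro t
      have ht : Filter.Tendsto (fun k => max (t - δ (φ k)) 0) Filter.atTop (𝓝 (max t 0)) := by
        simpa using (tendsto_const_nhds.sub hδφ).max (tendsto_const_nhds (x := (0 : ℝ)))
      have h1 := ((hF.continuous_comp_cubeClamp).tendsto _).comp (heval ht)
      have h2 := ((continuous_apply i).tendsto _).comp h1
      simpa using h2.add hδφ
    have h1 := tendsto_radialPotential (n := n) (C := C + 1)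
      (f := fun k t => G (φ k) (u (φ k) (max (t - δ (φ k)) 0)) i)
      (fun k => (continuous_apply i).comp ((hG _).comp ((u (φ k)).continuous.comp (by fun_prop))))
      (fun k t => hGC _ _ i) hsource (((continuous_apply i).tendsto _).comp halim) q
    have h2 := ((continuous_apply i).tendsto _).comp (heval (tendsto_const_nhds (x := q)))
    have h3 : w q i = radialPotential n (fun t => F (cubeClamp (w (max t 0))) i) (w 0 i) q := by
      refine tendsto_nhds_unique_of_eventuallyEq h2 h1 ?_
      filter_upwards [(tendsto_natCast_atTop_atTop.comp hφ.tendsto_atTop).eventually_ge_atTop q]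
        with k hk
      exact hueq (φ k) q h0 hk i
    rw [h3]
    exact radialPotential_congr h0 fun t ht => by rw [max_eq_left ht.1]
  · have h2 := ((continuous_apply i).tendsto _).comp (heval (tendsto_const_nhds (x := q)))
    refine ge_of_tendsto h2 ?_
    filter_upwards [hQ'.eventually (lt_mem_nhds hq)] with k hk
    have hqk : q ≤ Q (φ k) := ((ENNReal.ofReal_lt_ofReal_iff_of_nonneg h0).1 hk).le
    have h4 : u (φ k) (Q (φ k)) i = 0 := congrFun (hzero (φ k)) i
    exact h4 ▸ hanti (φ k) i hqk
  · have h1 : Filter.Tendsto (fun k => Q (φ k)) Filter.atTop (𝓝 Q'.toReal) := by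
      have := (ENNReal.tendsto_toReal hfin).comp hQ'
      refine this.congr fun k => ?_
      simp [ENNReal.toReal_ofReal (hQ (φ k))]
    refine tendsto_nhds_unique (heval h1) ?_
    have h2 : (fun k => u (φ k) (Q (φ k))) = fun _ => 0 := funext fun k => hzero (φ k)
    rw [h2]
    exact tendsto_const_nhds

end Limit

/-! ### Positivity and decay -/

section Positivity

variable {n L : ℕ} {F : (Fin L → ℝ) → Fin L → ℝ}

/-- A radial superharmonic function that vanishes before leaving `[0, ∞)` is trivial: by
monotonicity it vanishes on an interval, where the mean of its source must then vanish. -/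
theorem eq_zero_of_radialPotential_eq_zero {f : ℝ → ℝ} (hf : Continuous f) (h0 : ∀ t, 0 ≤ f t)
    {c q q' : ℝ} (hq : 0 ≤ q) (hqq' : q < q') (h : radialPotential n f c q = 0)
    (h' : 0 ≤ radialPotential n f c q') : c = 0 ∧ f 0 = 0 := by
  have hq' : 0 < q' := hq.trans_lt hqq'
  have hmean : radialMean n f q' = 0 := by
    by_contra hne
    have hpos : 0 < ∫ p in q..q', radialMean n f p :=
      intervalIntegral.integral_pos hqq' (continuous_radialMean hf).continuousOn
        (fun p _ => radialMean_nonneg h0 p)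
        ⟨q', Set.right_mem_Icc.2 hqq'.le, lt_of_le_of_ne (radialMean_nonneg h0 q') (Ne.symm hne)⟩
    have := radialPotential_sub (n := n) (c := c) hf q' q
    linarith
  have hvan : Set.EqOn f (fun _ => 0) (Set.Ioc 0 q') := by
    intro t ht
    by_contra hne
    have hτ : 0 < √(t / q') := Real.sqrt_pos.2 (div_pos ht.1 hq')
    have ht' : q' * √(t / q') ^ 2 = t := by
      rw [Real.sq_sqrt (div_pos ht.1 hq').le]
      field_simp
    have hpos : 0 < ∫ τ in (0 : ℝ)..1, τ ^ (n - 1) * f (q' * τ ^ 2) := by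
      refine intervalIntegral.integral_pos one_pos (by fun_prop)
        (fun τ hτ => mul_nonneg (pow_nonneg hτ.1.le _) (h0 _)) ⟨√(t / q'), ⟨hτ.le, ?_⟩, ?_⟩
      · exact Real.sqrt_le_one.2 ((div_le_one hq').2 ht.2)
      · rw [ht']
        exact mul_pos (pow_pos hτ _) (lt_of_le_of_ne (h0 t) (Ne.symm hne))
    exact hpos.ne' hmean
  have hvan' : Set.EqOn f (fun _ => 0) (Set.Icc 0 q') := by
    rw [← closure_Ioc hq'.ne]
    exact hvan.closure hf continuous_const
  refine ⟨?_, hvan' (Set.left_mem_Icc.2 hq'.le)⟩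
  have hconst : radialPotential n f c q = radialPotential n (fun _ => 0) c q :=
    radialPotential_congr hq fun t ht => hvan' ⟨ht.1, ht.2.trans hqq'.le⟩
  rw [h] at hconst
  simpa [radialPotential, radialMean] using hconst.symm

/-- The source of a nonnegative radial superharmonic function cannot have a positive limit at
infinity: the function would decrease at least linearly in `|x|²`. -/
theorem source_limit_nonpos (hn : 1 ≤ n) {f : ℝ → ℝ} (hf : Continuous f) {C c d : ℝ}
    (hC : ∀ t, |f t| ≤ C) (hpot : ∀ q, 0 ≤ radialPotential n f c q)
    (hlim : Filter.Tendsto f Filter.atTop (𝓝 d)) : d ≤ 0 := by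
  by_contra! hd
  have hn0 : (0 : ℝ) < n := by exact_mod_cast hn
  have hmean : Filter.Tendsto (radialMean n f) Filter.atTop (𝓝 (d / n)) := by
    rw [← radialMean_const hn d 0]
    refine intervalIntegral.tendsto_integral_filter_of_dominated_convergence (fun _ => C)
      (.of_forall fun p => Continuous.aestronglyMeasurable (by fun_prop))
      (.of_forall fun p => .of_forall fun τ hτ => norm_pow_mul_le hτ (hC _))
      (by simp) (.of_forall fun τ hτ => ?_)
    rw [Set.uIoc_of_le zero_le_one] at hτ
    exact (hlim.comp (Filter.tendsto_id.atTop_mul_const (pow_pos hτ.1 2))).const_mul _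
  obtain ⟨P, hP⟩ := Filter.eventually_atTop.1
    (hmean.eventually (lt_mem_nhds (show d / (2 * n) < d / n by
      apply div_lt_div_of_pos_left hd hn0; linarith)))
  set η := d / (2 * n) with hη
  have hη0 : 0 < η := by positivity
  have hdecr : ∀ q, P ≤ q → radialPotential n f c q ≤ radialPotential n f c P - η / 2 * (q - P) := by
    intro q hq
    have h1 : ∫ _ in P..q, η ≤ ∫ p in P..q, radialMean n f p :=
      intervalIntegral.integral_mono_on hq (by simp)
        ((continuous_radialMean hf).intervalIntegrable _ _) fun p hp => (hP p hp.1).le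
    rw [intervalIntegral.integral_const, smul_eq_mul] at h1
    have h2 := radialPotential_sub (n := n) (c := c) hf q P
    linarith
  set A := radialPotential n f c P with hA
  have hA0 : 0 ≤ A := hpot P
  have h1 := hdecr (P + 2 * (A + 1) / η) (le_add_of_nonneg_right (by positivity))
  have h2 : η / 2 * (P + 2 * (A + 1) / η - P) = A + 1 := by
    field_simp
    ring
  have h3 := hpot (P + 2 * (A + 1) / η)
  linarith

/-- Non-degeneracy in pointwise form: on the boundary of the orthant, away from the origin, some
vanishing component has a positive source. -/
theorem IsNondegenerate.exists_pos (hnd : IsNondegenerate F) {v : Fin L → ℝ}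
    (hv : v ∈ closedOrthant L) {i j : Fin L} (hi : v i = 0) (hj : v j ≠ 0) :
    ∃ k, v k = 0 ∧ 0 < F v k := by
  classical
  let S : Finset (Fin L) := Finset.univ.filter fun k => v k ≠ 0
  have hSc : ∀ k, k ∈ Sᶜ ↔ v k = 0 := fun k => by simp [S]
  have hsum := hnd S ⟨j, by simpa [S] using hj⟩ ⟨i, (hSc i).2 hi⟩ v
    (fun k hk => lt_of_le_of_ne (hv k) (Ne.symm (by simpa [S] using hk)))
    fun k hk => (hSc k).1 hk
  obtain ⟨k, hk, hpos⟩ := Finset.exists_lt_of_sum_lt (f := fun _ => (0 : ℝ)) (s := Sᶜ)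
    (by simpa using hsum)
  exact ⟨k, (hSc k).1 hk, hpos⟩

theorem exists_ne_zero_of_mem_stdSimplex {a : Fin L → ℝ} (ha : a ∈ stdSimplex ℝ (Fin L)) :
    ∃ j, a j ≠ 0 := by
  by_contra! h
  have := ha.2
  simp [h] at this

/-- The limit solution is an entire solution, and a single solution serves both assertions: it
decays as soon as `F` has no zero in the open orthant. -/
theorem exists_isEntireSolution_tendsto [NeZero L] (hn : 1 ≤ n) (hF : IsAdmissible F)
    (hnd : IsNondegenerate F)
    (hno : ∀ R : ℝ, 0 < R →
      ¬ ∃ u : EuclideanSpace ℝ (Fin n) → Fin L → ℝ, IsDirichletSolution F R u) :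
    ∃ u : EuclideanSpace ℝ (Fin n) → Fin L → ℝ, IsEntireSolution F u ∧
      ((∀ v ∈ openOrthant L, F v ≠ 0) →
        Filter.Tendsto u (Filter.cocompact (EuclideanSpace ℝ (Fin n))) (𝓝 0)) := by
  obtain ⟨a, ha, u, Q, hu, hnonneg, hvanish⟩ := exists_radial_solution_vanishing hn hF
  set f : Fin L → ℝ → ℝ := fun i t => F (cubeClamp (u t)) i with hfdef
  have hf : ∀ i, Continuous (f i) := fun i =>
    (continuous_apply i).comp (hF.continuous_comp_cubeClamp.comp u.continuous)
  have hf0 : ∀ i t, 0 ≤ f i t := fun i t => hF.comp_cubeClamp_nonneg _ i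
  have hu0 : u 0 = a := funext fun i => by rw [hu 0 le_rfl, radialPotential_zero]
  have ha1 : ∀ i, a i ≤ 1 := fun i =>
    (le_abs_self _).trans ((norm_le_pi_norm a i).trans (norm_le_one_of_mem_stdSimplex ha))
  have hle1 : ∀ q, 0 ≤ q → ∀ i, u q i ≤ 1 := by
    intro q hq i
    rw [hu q hq]
    refine (antitone_radialPotential (hf i) (hf0 i) hq).trans ?_
    rw [radialPotential_zero]
    exact ha1 i
  obtain ⟨j, hj⟩ := exists_ne_zero_of_mem_stdSimplex ha
  have hQ0 : Q ≠ 0 := by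
    rintro rfl
    have := hvanish ENNReal.zero_ne_top
    rw [ENNReal.toReal_zero, hu0] at this
    exact hj (congrFun this j)
  have hcube : ∀ q, 0 ≤ q → ENNReal.ofReal q < Q → cubeClamp (u q) = u q := fun q hq hqQ =>
    cubeClamp_eq_self fun i => ⟨hnonneg q hq hqQ i, hle1 q hq i⟩
  -- A component that vanishes before time `Q` vanishes at the origin together with its source.
  have htriv : ∀ q, 0 ≤ q → ENNReal.ofReal q < Q → ∀ i, u q i = 0 → a i = 0 ∧ F a i = 0 := by
    intro q hq hqQ i hi
    obtain ⟨r, hqr, hrQ⟩ := exists_between hqQ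
    have hr : r ≠ ⊤ := hrQ.ne_top
    have hqr' : q < r.toReal := (ENNReal.ofReal_lt_iff_lt_toReal hq hr).1 hqr
    have hr0 : 0 ≤ r.toReal := ENNReal.toReal_nonneg
    have h1 := eq_zero_of_radialPotential_eq_zero (n := n) (hf i) (hf0 i) hq hqr'
      (by rw [← hu q hq, hi])
      (by rw [← hu _ hr0]; exact hnonneg _ hr0 (by rwa [ENNReal.ofReal_toReal hr]) i)
    refine ⟨h1.1, ?_⟩
    rw [← h1.2]
    simp only [hfdef]
    rw [hcube 0 le_rfl (by rw [ENNReal.ofReal_zero]; exact pos_iff_ne_zero.2 hQ0), hu0]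
  have hapos : ∀ i, a i ≠ 0 := by
    intro i hi
    obtain ⟨k, hk, hpos⟩ := hnd.exists_pos ha.1 hi hj
    have := (htriv 0 le_rfl (by rw [ENNReal.ofReal_zero]; exact pos_iff_ne_zero.2 hQ0) k
      (by rw [hu0, hk])).2
    exact hpos.ne' this
  have hupos : ∀ q, 0 ≤ q → ENNReal.ofReal q < Q → ∀ i, 0 < u q i := fun q hq hqQ i =>
    lt_of_le_of_ne (hnonneg q hq hqQ i) fun h => hapos i (htriv q hq hqQ i h.symm).1
  set w : EuclideanSpace ℝ (Fin n) → Fin L → ℝ := fun x => u (‖x‖ ^ 2) with hwdef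
  have hwi : ∀ i, (fun x => w x i) = fun x => radialPotential n (f i) (a i) (‖x‖ ^ 2) :=
    fun i => funext fun x => hu _ (sq_nonneg _) i
  have hwcd : ∀ i, ContDiff ℝ 2 fun x => w x i := fun i => by
    rw [hwi]
    exact contDiff_radialPotential hn (hf i) (a i)
  have hweq : ∀ i x, ENNReal.ofReal (‖x‖ ^ 2) < Q →
      -(Laplacian.laplacian (fun y => w y i) x) = F (w x) i := by
    intro i x hx
    rw [hwi, laplacian_radialPotential hn (hf i), neg_neg]
    simp only [hfdef]
    rw [hcube _ (sq_nonneg _) hx]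
  have hQtop : Q = ⊤ := by
    by_contra hfin
    have hQpos : 0 < Q.toReal := ENNReal.toReal_pos hQ0 hfin
    refine hno (√Q.toReal) (Real.sqrt_pos.2 hQpos) ⟨w, ?_⟩
    have hball : ∀ x ∈ Metric.ball (0 : EuclideanSpace ℝ (Fin n)) (√Q.toReal),
        ENNReal.ofReal (‖x‖ ^ 2) < Q := by
      intro x hx
      rw [mem_ball_zero_iff] at hx
      rw [ENNReal.ofReal_lt_iff_lt_toReal (sq_nonneg _) hfin]
      exact (Real.lt_sqrt (norm_nonneg x)).1 hx
    exact {
      contDiffOn := fun i => (hwcd i).contDiffOn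
      continuousOn := fun i => (hwcd i).continuous.continuousOn
      equation := fun i x hx => hweq i x (hball x hx)
      pos := fun i x hx => hupos _ (sq_nonneg _) (hball x hx) i
      boundary := fun i x hx => by
        simp only [hwdef]
        rw [mem_sphere_zero_iff_norm.1 hx, Real.sq_sqrt hQpos.le, hvanish hfin, Pi.zero_apply] }
  subst hQtop
  refine ⟨w, ⟨hwcd, fun i x => hweq i x ENNReal.ofReal_lt_top,
    fun i x => hupos _ (sq_nonneg _) ENNReal.ofReal_lt_top i⟩, fun hne => ?_⟩
  have hpot0 : ∀ i q, 0 ≤ radialPotential n (f i) (a i) q := by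
    intro i q
    rcases le_total 0 q with hq | hq
    · rw [← hu q hq]
      exact hnonneg q hq ENNReal.ofReal_lt_top i
    · refine le_trans ?_ (antitone_radialPotential (hf i) (hf0 i) hq)
      rw [radialPotential_zero]
      exact ha.1 i
  set ℓ : Fin L → ℝ := fun i => ⨅ q, radialPotential n (f i) (a i) q with hℓ
  have hulim : Filter.Tendsto u Filter.atTop (𝓝 ℓ) := by
    refine tendsto_pi_nhds.2 fun i => ?_
    refine (tendsto_atTop_ciInf (antitone_radialPotential (hf i) (hf0 i))
      ⟨0, Set.forall_mem_range.2 (hpot0 i)⟩).congr' ?_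
    filter_upwards [Filter.eventually_ge_atTop 0] with q hq
    exact (hu q hq i).symm
  have hℓ0 : ∀ i, 0 ≤ ℓ i := fun i => le_ciInf (hpot0 i)
  have hℓcube : cubeClamp ℓ = ℓ := by
    refine cubeClamp_eq_self fun i => ⟨hℓ0 i, le_of_tendsto (tendsto_pi_nhds.1 hulim i) ?_⟩
    filter_upwards [Filter.eventually_ge_atTop 0] with q hq
    exact hle1 q hq i
  obtain ⟨C, -, hC⟩ := hF.exists_bound
  have hFℓ : F ℓ = 0 := by
    funext i
    refine le_antisymm (source_limit_nonpos hn (hf i) (fun t => hC _ i) (hpot0 i) ?_)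
      (hF.mapsTo hℓ0 i)
    rw [← hℓcube]
    exact ((continuous_apply i).tendsto _).comp
      ((hF.continuous_comp_cubeClamp.tendsto _).comp hulim)
  have hℓz : ℓ = 0 := by
    by_contra hℓne
    obtain ⟨j, hj⟩ := Function.ne_iff.1 hℓne
    by_cases hpos : ∀ i, ℓ i ≠ 0
    · exact hne ℓ (fun i => lt_of_le_of_ne (hℓ0 i) (hpos i).symm) hFℓ
    · push Not at hpos
      obtain ⟨i, hi⟩ := hpos
      obtain ⟨k, -, hk⟩ := hnd.exists_pos hℓ0 hi hj
      rw [hFℓ] at hk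
      exact lt_irrefl _ hk
  rw [hℓz] at hulim
  exact hulim.comp ((Filter.tendsto_pow_atTop two_ne_zero).comp
    (tendsto_norm_cocompact_atTop (E := EuclideanSpace ℝ (Fin n))))

end Positivity

theorem theorem1 (n L : ℕ) (hn : 1 ≤ n) (F : (Fin L → ℝ) → Fin L → ℝ)
    (hF : IsAdmissible F) (hnd : IsNondegenerate F)
    (hno : ∀ R : ℝ, 0 < R →
      ¬ ∃ u : EuclideanSpace ℝ (Fin n) → Fin L → ℝ, IsDirichletSolution F R u) :
    (∃ u : EuclideanSpace ℝ (Fin n) → Fin L → ℝ, IsEntireSolution F u) ∧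
    ((∀ v ∈ openOrthant L, F v ≠ 0) →
      ∃ u : EuclideanSpace ℝ (Fin n) → Fin L → ℝ, IsEntireSolution F u ∧
        Filter.Tendsto u (Filter.cocompact (EuclideanSpace ℝ (Fin n))) (𝓝 0)) := by
  rcases Nat.eq_zero_or_pos L with rfl | hL
  · -- The empty system is solved by the empty map.
    have hw : ∀ u : EuclideanSpace ℝ (Fin n) → Fin 0 → ℝ, IsEntireSolution F u := fun u =>
      ⟨fun i => i.elim0, fun i => i.elim0, fun i => i.elim0⟩
    exact ⟨⟨0, hw 0⟩, fun _ => ⟨0, hw 0, tendsto_const_nhds⟩⟩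
  · have : NeZero L := ⟨hL.ne'⟩
    obtain ⟨u, hu, hlim⟩ := exists_isEntireSolution_tendsto hn hF hnd hno
    exact ⟨⟨u, hu⟩, fun hne => ⟨u, hu, hlim hne⟩⟩
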